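/- All Hilbert spaces are finite-dimensional, a density matrix is a positive semi-definite operator of trace one, and unitary representations are continuous. Let $G$ be a connected Lie group. A quantum channel is a completely positive trace-preserving linear map. For unitary representations $W,W'$ of $G$ on the input and the output, a channel $T$ is covariant (from $W$ to $W'$) if $T[W(g)XW(g)^\dagger]=W'(g)T[X]W'(g)^\dagger$ for all $g\in G$ and all $X$. For a unitary $U$ on $A\otimes E$ and a density matrix $\omega$ on $E$ write $T_{U,\omega}[X]=\mathrm{Tr}_E[U(X\otimes\omega)U^\dagger]$. For a Hermitian operator $H_E$ and $\beta>0$ let $\omega_\beta(H_E)=e^{-\beta H_E}/\mathrm{Tr}\,e^{-\beta H_E}$ be the Gibbs state. A thermal operation at inverse temperature $\beta$ on a system $A$ with Hamiltonian $H_A$ is a map $T_{U,\omega_\beta(H_E)}$, where $E\neq 0$ is a system with Hamiltonian $H_E$ and $U$ is a unitary on $A\otimes E$ commuting with $H_A\otimes 1+1\otimes H_E$. Tensor factors are reordered where needed. (1) Let $W_S,W'_S$ be unitary representations of $G$ on $S$ and $W_C$ one on $C$. Let $\rho_S,\rho'_S$ be density matrices on $S$ and $\sigma_C$ a density matrix on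 $C$, and let $U$ be a unitary on $S\otimes C$ with $U(\rho_S\otimes\sigma_C)U^\dagger=\rho'_S\otimes\sigma_C$ and $U\,(W_S(g)\otimes W_C(g))=(W'_S(g)\otimes W_C(g))\,U$ for all $g\in G$. Then there is a unitary $V$ on $S$ with $V\rho_SV^\dagger=\rho'_S$ and $VW_S(g)=W'_S(g)V$ for all $g\in G$. (2) (An exact, uncorrelated catalyst is useless: asymmetry.) Let moreover $W_E,W'_E$ be unitary representations of $G$ on $E$, let $\omega_E$ be a density matrix on $E$ with $W_E(g)\omega_EW_E(g)^\dagger=\omega_E$ for all $g\in G$, and let $U$ be a unitary on $S\otimes C\otimes E$ that intertwines $W_S\otimes W_C\otimes W_E$ with $W'_S\otimes W_C\otimes W'_E$. If $U(\rho_S\otimes\sigma_C\otimes\omega_E)U^\dagger=\tau_{SE}\otimes\sigma_C$ for some operator $\tau_{SE}$ on $S\otimes E$, then there is a unitary $V$ on $S\otimes E$, intertwining $W_S\otimes W_E$ with $W'_S\otimes W'_E$, such that $V(\rho_S\otimes\omega_E)V^\dagger=\tau_{SE}$. The map $T_{V,\omega_E}$ is a covariant channel on $S$ from $W_S$ to $W'_S$,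 and $T_{U,\omega_E}[\rho_S\otimes\sigma_C]=T_{V,\omega_E}[\rho_S]\otimes\sigma_C$. (3) (The same: athermality.) Let $S,C,E$, with $E\neq 0$, have Hamiltonians $H_S,H_C,H_E$, let $\beta>0$ and $\omega_E=\omega_\beta(H_E)$, and let $U$ be a unitary on $S\otimes C\otimes E$ that commutes with the sum of the three Hamiltonians. If $U(\rho_S\otimes\sigma_C\otimes\omega_E)U^\dagger=\tau_{SE}\otimes\sigma_C$ for density matrices $\rho_S,\sigma_C$ and some operator $\tau_{SE}$ on $S\otimes E$, then there is a unitary $V$ on $S\otimes E$, commuting with $H_S\otimes 1+1\otimes H_E$, such that $V(\rho_S\otimes\omega_E)V^\dagger=\tau_{SE}$. The map $T_{V,\omega_E}$ is a thermal operation on $S$ at inverse temperature $\beta$, and $T_{U,\omega_E}[\rho_S\otimes\sigma_C]=T_{V,\omega_E}[\rho_S]\otimes\sigma_C$. (4) (Pure catalysts are useless: asymmetry.) Let $\sigma_C$ be a pure state, and let $T$ be any channel on $S\otimes C$ that is covariant from $W_S\otimes W_C$ to $W'_S\otimes W_C$. If $T[\rho_S\otimes\sigma_C]=\rho'_S\otimes\sigma_C$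 for density matrices $\rho_S,\rho'_S$, then there is a channel $T'$ on $S$, covariant from $W_S$ to $W'_S$, with $T'[\rho_S]=\rho'_S$. (5) (The same: athermality.) Let $\sigma_C$ be a pure state, $\beta>0$, and let $T$ be a thermal operation at inverse temperature $\beta$ on $S\otimes C$ with Hamiltonian $H_S\otimes 1+1\otimes H_C$. If $T[\rho_S\otimes\sigma_C]=\rho'_S\otimes\sigma_C$ for density matrices $\rho_S,\rho'_S$, then there is a thermal operation $T'$ at inverse temperature $\beta$ on $S$ with Hamiltonian $H_S$ such that $T'[\rho_S]=\rho'_S$. -/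

import Mathlib

open scoped Kronecker ContDiff ComplexOrder

noncomputable section

namespace QuantumCatalysis

/-! A finite-dimensional quantum system is described by a finite index set `A` labelling an
orthonormal basis of its Hilbert space `ℂ^A`; the composite of `A` and `B` is `A × B`, with
tensor products given by Kronecker products. -/

/-- A density matrix: positive semi-definite with unit trace. -/
def IsDensityMatrix {A : Type*} [Fintype A] (ρ : Matrix A A ℂ) : Prop :=
  ρ.PosSemidef ∧ ρ.trace = 1

/-- A pure state `|ψ⟩⟨ψ|` with `⟨ψ, ψ⟩ = 1`. -/
def IsPureState {A : Type*} [Fintype A] (σ : Matrix A A ℂ) : Prop :=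
  ∃ ψ : A → ℂ, dotProduct (star ψ) ψ = 1 ∧ σ = Matrix.vecMulVec ψ (star ψ)

/-- The tensor product `g ↦ W(g) ⊗ W'(g)` of two unitary representations. -/
def tensorRep {G : Type*} [Group G] {A B : Type*} [Fintype A] [DecidableEq A]
    [Fintype B] [DecidableEq B]
    (W : G →* Matrix.unitaryGroup A ℂ) (W' : G →* Matrix.unitaryGroup B ℂ) :
    G →* Matrix.unitaryGroup (A × B) ℂ where
  toFun g := ⟨(W g : Matrix A A ℂ) ⊗ₖ (W' g : Matrix B B ℂ),
    Matrix.kronecker_mem_unitary (W g).2 (W' g).2⟩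
  map_one' := by
    apply Subtype.ext
    simp
  map_mul' g h := by
    apply Subtype.ext
    simp [Matrix.mul_kronecker_mul]

/-- A unitary `U` intertwines the unitary representations `W` and `W'`:
`U W(g) = W'(g) U` for all `g`. -/
def Intertwines {G : Type*} [Group G] {A : Type*} [Fintype A] [DecidableEq A]
    (U : Matrix.unitaryGroup A ℂ) (W W' : G →* Matrix.unitaryGroup A ℂ) : Prop :=
  ∀ g : G, (U : Matrix A A ℂ) * (W g : Matrix A A ℂ) = (W' g : Matrix A A ℂ) * (U : Matrix A A ℂ)

/-- A state (or matrix) is symmetric if it is invariant under conjugation by the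
representation. -/
def IsSymmetricState {G : Type*} [Group G] {A : Type*} [Fintype A] [DecidableEq A]
    (W : G →* Matrix.unitaryGroup A ℂ) (γ : Matrix A A ℂ) : Prop :=
  ∀ g : G, (W g : Matrix A A ℂ) * γ * (W g : Matrix A A ℂ).conjTranspose = γ

/-- The map `id ⊗ T` (ancilla `Fin k`), i.e. `T` applied to each block of a block matrix. -/
def ampliation {A B : Type*} (T : Matrix A A ℂ →ₗ[ℂ] Matrix B B ℂ) (k : ℕ)
    (X : Matrix (Fin k × A) (Fin k × A) ℂ) : Matrix (Fin k × B) (Fin k × B) ℂ :=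
  Matrix.of fun p q => T (Matrix.of fun a a' => X (p.1, a) (q.1, a')) p.2 q.2

/-- A quantum channel: a completely positive trace-preserving linear map. -/
def IsQuantumChannel {A B : Type*} [Fintype A] [Fintype B]
    (T : Matrix A A ℂ →ₗ[ℂ] Matrix B B ℂ) : Prop :=
  (∀ (k : ℕ) (X : Matrix (Fin k × A) (Fin k × A) ℂ),
      X.PosSemidef → (ampliation T k X).PosSemidef) ∧
    ∀ X : Matrix A A ℂ, (T X).trace = X.trace

/-- A covariant quantum channel, with representation `W` on the input and `W'` on the output. -/
def IsCovariantChannel {G : Type*} [Group G] {A B : Type*} [Fintype A] [DecidableEq A]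
    [Fintype B] [DecidableEq B]
    (W : G →* Matrix.unitaryGroup A ℂ) (W' : G →* Matrix.unitaryGroup B ℂ)
    (T : Matrix A A ℂ →ₗ[ℂ] Matrix B B ℂ) : Prop :=
  IsQuantumChannel T ∧ ∀ (g : G) (X : Matrix A A ℂ),
    T ((W g : Matrix A A ℂ) * X * (W g : Matrix A A ℂ).conjTranspose) =
      (W' g : Matrix B B ℂ) * T X * (W' g : Matrix B B ℂ).conjTranspose

/-- The partial trace over the second tensor factor. -/
def partialTrace {A E : Type*} [Fintype E] (X : Matrix (A × E) (A × E) ℂ) : Matrix A A ℂ :=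
  Matrix.of fun a a' => ∑ e, X (a, e) (a', e)

/-- The map `X ↦ Tr_E [U (X ⊗ γ) U†]` on `A` which appends an environment `E` in state `γ`,
applies the unitary `U` and discards `E`. -/
def dilatedMap {A E : Type*} [Fintype A] [DecidableEq A] [Fintype E] [DecidableEq E]
    (U : Matrix.unitaryGroup (A × E) ℂ) (γ : Matrix E E ℂ) :
    Matrix A A ℂ →ₗ[ℂ] Matrix A A ℂ where
  toFun X := partialTrace ((U : Matrix (A × E) (A × E) ℂ) * (X ⊗ₖ γ) *
    (U : Matrix (A × E) (A × E) ℂ).conjTranspose)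
  map_add' X Y := by
    ext a a'
    simp [partialTrace, Matrix.add_kronecker, Matrix.mul_add, Matrix.add_mul,
      Finset.sum_add_distrib]
  map_smul' c X := by
    ext a a'
    simp [partialTrace, Matrix.smul_kronecker, Finset.mul_sum]

/-- Reordering of tensor factors from `(S ⊗ C) ⊗ E` to `(S ⊗ E) ⊗ C`. -/
def reorder {S C E : Type*} (X : Matrix ((S × C) × E) ((S × C) × E) ℂ) :
    Matrix ((S × E) × C) ((S × E) × C) ℂ :=
  Matrix.of fun p q => X ((p.1.1, p.2), p.1.2) ((q.1.1, q.2), q.1.2)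

/-- The Hamiltonian `H ⊗ 1 + 1 ⊗ H'` of two non-interacting systems. -/
def totalHamiltonian {A B : Type*} [DecidableEq A] [DecidableEq B]
    (H : Matrix A A ℂ) (H' : Matrix B B ℂ) : Matrix (A × B) (A × B) ℂ :=
  H ⊗ₖ (1 : Matrix B B ℂ) + (1 : Matrix A A ℂ) ⊗ₖ H'

/-- The Gibbs state `exp(-βH) / Tr exp(-βH)`. -/
def gibbsState {A : Type*} [Fintype A] [DecidableEq A] (β : ℝ) (H : Matrix A A ℂ) :
    Matrix A A ℂ :=
  (NormedSpace.exp (-(β : ℂ) • H)).trace⁻¹ • NormedSpace.exp (-(β : ℂ) • H)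

/-- A thermal operation at inverse temperature `β` on a system with Hamiltonian `H`: a map
`X ↦ Tr_E [U (X ⊗ γ_E) U†]` with a (finite-dimensional, non-zero) environment `E` in its Gibbs
state and an energy-conserving unitary `U`. -/
def IsThermalOperation {A : Type*} [Fintype A] [DecidableEq A] (β : ℝ) (H : Matrix A A ℂ)
    (T : Matrix A A ℂ →ₗ[ℂ] Matrix A A ℂ) : Prop :=
  ∃ (n : ℕ) (HE : Matrix (Fin n) (Fin n) ℂ) (U : Matrix.unitaryGroup (A × Fin n) ℂ),
    0 < n ∧ HE.IsHermitian ∧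
    Commute (U : Matrix (A × Fin n) (A × Fin n) ℂ) (totalHamiltonian H HE) ∧
    T = dilatedMap U (gibbsState β HE)

end QuantumCatalysis

end

/-! The catalyst cancels from traces. Take any word in the letters `ρ ⊗ σ` and `W_S(g) ⊗ W_C(g)`.
Its trace is a product of a system trace and a catalyst trace, and conjugation by `U` replaces only
the system trace, by the one of `ρ'` and `W'_S`. Hence (system trace - new system trace) * (catalyst
trace) = 0, even when each letter carries its own independent group element. As functions of all
these elements, the factors are polynomials in matrix coefficients of a connected group, namely a
power of `G`. Such functions have no zero divisors (`IsTranslationAlgebra.eq_zero_or_eq_zero`). At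
the identity the catalyst trace is the trace of a power of `σ`, which is not zero. So the system
traces agree for every word (`trace_wordProd_eq_of_catalysis`).

Two star-closed families with equal word traces are unitarily equivalent. A Casimir element of the
trace form supplies a nonzero intertwiner, its polar part is a partial isometry, and a maximal
partial isometry exhausts the space (`exists_partialIsometry_of_trace_eq`). This gives `V` in (1).
Part (2) is the same statement for the system `S ⊗ E`, and (3) is (2) for time evolution, a
representation of the connected group `ℝ`.

For a pure catalyst, the dilated output has a pure marginal on `C`, so it is automatically a product
(`exists_reorder_eq_of_isPureState`), and (5) reduces to (3). In (4) the dilation is only a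
covariant isometry `K`. Then traces are preserved just for words that contain the state. These words
span a two-sided ideal, and the equivalence holds where that ideal acts, in particular on the
support of `ρ`. The resulting covariant partial isometry is completed to a covariant channel. -/

noncomputable section

namespace QuantumCatalysis

open Matrix

/-! ### Representative functions on a connected group -/

section RepresentativeFunctions

variable {H : Type*} [Group H]

/-- Left translation of complex functions on a group. -/
def leftTranslation (h : H) : (H → ℂ) →ₐ[ℂ] (H → ℂ) where
  toFun f := fun x => f (h * x)
  map_one' := rfl
  map_mul' _ _ := rfl
  map_zero' := rfl
  map_add' _ _ := rfl
  commutes' _ := rfl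

/-- A finitely generated, translation invariant algebra of continuous functions on a group. -/
structure IsTranslationAlgebra [TopologicalSpace H] (B : Subalgebra ℂ (H → ℂ)) : Prop where
  fg : B.FG
  translate : ∀ h, B ≤ B.comap (leftTranslation h)
  continuous : B ≤ continuousSubalgebra

/-- Places two representative functions in one common algebra, so that their product can be studied
there. -/
theorem IsTranslationAlgebra.sup [TopologicalSpace H] {B B' : Subalgebra ℂ (H → ℂ)}
    (hB : IsTranslationAlgebra B) (hB' : IsTranslationAlgebra B') :
    IsTranslationAlgebra (B ⊔ B') where
  fg := hB.fg.sup hB'.fg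
  translate h := sup_le
    (fun _ hf => (le_sup_left : B ≤ B ⊔ B') (hB.translate h hf))
    (fun _ hf => (le_sup_right : B' ≤ B ⊔ B') (hB'.translate h hf))
  continuous := sup_le hB.continuous hB'.continuous

/-- Translation invariant finitely generated algebras of continuous functions on a connected group
have no zero divisors: each point lies on exactly one irreducible component of the spectrum, so that
the components are disjoint and closed. -/
theorem IsTranslationAlgebra.eq_zero_or_eq_zero [TopologicalSpace H] [ConnectedSpace H]
    {B : Subalgebra ℂ (H → ℂ)} (hB : IsTranslationAlgebra B) {f₁ f₂ : H → ℂ}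
    (h₁ : f₁ ∈ B) (h₂ : f₂ ∈ B) (h : f₁ * f₂ = 0) : f₁ = 0 ∨ f₂ = 0 := by
  have hft : Algebra.FiniteType ℂ B := B.fg_iff_finiteType.1 hB.fg
  have hnoeth : IsNoetherianRing B := Algebra.FiniteType.isNoetherianRing ℂ B
  have hfin : (minimalPrimes B).Finite := minimalPrimes.finite_of_isNoetherianRing B
  let ev : H → B →+* ℂ := fun h => (Pi.evalRingHom (fun _ : H => ℂ) h).comp B.val.toRingHom
  have hprime : ∀ h, (RingHom.ker (ev h)).IsPrime := fun h => RingHom.ker_isPrime (ev h)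
  -- the translations of `B`
  let tr : H → B →+* B := fun h =>
    (((leftTranslation h).comp B.val).codRestrict B (fun f => hB.translate h f.2)).toRingHom
  have htr : ∀ h (f : B) x, (tr h f : H → ℂ) x = (f : H → ℂ) (h * x) := fun _ _ _ => rfl
  have hev : ∀ h (f : B), ev h f = (f : H → ℂ) h := fun _ _ => rfl
  have htr1 : ∀ h f, tr h (tr h⁻¹ f) = f := by
    intro h f; ext x; rw [htr, htr]; simp
  have htr2 : ∀ h f, tr h⁻¹ (tr h f) = f := by
    intro h f; ext x; rw [htr, htr]; simp
  -- Translations are automorphisms of `B`, with inverse given by the inverse group element, so they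
  -- permute the minimal primes.
  have hmin : ∀ h p, p ∈ minimalPrimes B → p.comap (tr h) ∈ minimalPrimes B := by
    intro h p hp
    have : p.IsPrime := hp.1.1
    refine ⟨⟨Ideal.comap_isPrime _ _, bot_le⟩, ?_⟩
    rintro q ⟨hq, -⟩ hqp
    have hle : q.comap (tr h⁻¹) ≤ p := by
      intro f hf
      have := hqp hf
      rw [Ideal.mem_comap, htr1] at this
      exact this
    have := hp.2 ⟨Ideal.comap_isPrime _ _, bot_le⟩ hle
    intro f hf
    have := this hf
    rw [Ideal.mem_comap, htr2] at this
    exact this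
  have hexists : ∀ h, ∃ p ∈ minimalPrimes B, p ≤ RingHom.ker (ev h) := by
    intro h
    have := hprime h
    obtain ⟨p, hp, hle⟩ := Ideal.exists_minimalPrimes_le (bot_le : ⊥ ≤ RingHom.ker (ev h))
    exact ⟨p, hp, hle⟩
  -- some point lies on one component only
  obtain ⟨x₀⟩ : Nonempty H := inferInstance
  obtain ⟨p, hp, -⟩ := hexists x₀
  have hpp : p.IsPrime := hp.1.1
  -- Otherwise `p` would contain the finite intersection of the other minimal primes, hence one of
  -- them. A point where `f` does not vanish lies on no component other than that of `p`.
  obtain ⟨f, hfq, hfp⟩ : ∃ f : B, (∀ q ∈ minimalPrimes B, q ≠ p → f ∈ q) ∧ f ∉ p := by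
    by_contra hcon
    push Not at hcon
    have hle : (hfin.toFinset.erase p).inf id ≤ p := by
      intro f hf
      refine hcon f fun q hq hqp => ?_
      have := Finset.inf_le (f := id) (Finset.mem_erase.2 ⟨hqp, hfin.mem_toFinset.2 hq⟩)
      exact this hf
    obtain ⟨q, hq, hqp⟩ := (Ideal.IsPrime.inf_le' hpp).1 hle
    rw [Finset.mem_erase, Set.Finite.mem_toFinset] at hq
    exact hq.1 (le_antisymm hqp (hp.2 ⟨hq.2.1.1, bot_le⟩ hqp))
  obtain ⟨h₀, hh₀⟩ : ∃ h, (f : H → ℂ) h ≠ 0 := by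
    by_contra hcon
    push Not at hcon
    exact hfp ((Subtype.ext (funext hcon) : f = 0) ▸ p.zero_mem)
  have huniq₀ : ∀ q ∈ minimalPrimes B, q ≤ RingHom.ker (ev h₀) → q = p := by
    intro q hq hle
    by_contra hqp
    exact hh₀ (hle (hfq q hq hqp))
  -- Translation by `h₀ * h⁻¹` carries the components through `h` to components through `h₀`, where
  -- there is only one.
  have huniq : ∀ h, ∀ q ∈ minimalPrimes B, ∀ r ∈ minimalPrimes B, q ≤ RingHom.ker (ev h) →
      r ≤ RingHom.ker (ev h) → q ≤ r := by
    intro h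
    have key : ∀ q ∈ minimalPrimes B, q ≤ RingHom.ker (ev h) →
        q.comap (tr (h₀ * h⁻¹)) = p := by
      intro q hq hle
      refine huniq₀ _ (hmin _ _ hq) fun f hf => ?_
      have := hle hf
      rw [RingHom.mem_ker, hev, htr] at this
      rw [RingHom.mem_ker, hev]
      simpa using this
    intro q hq r hr hq' hr' f hf
    have : tr (h₀ * h⁻¹)⁻¹ f ∈ q.comap (tr (h₀ * h⁻¹)) := by
      rw [Ideal.mem_comap, htr1]; exact hf
    rw [key q hq hq', ← key r hr hr', Ideal.mem_comap, htr1] at this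
    exact this
  -- the components are disjoint and closed
  let Z : Ideal B → Set H := fun q => {h | q ≤ RingHom.ker (ev h)}
  have hclosed : ∀ q, IsClosed (Z q) := by
    intro q
    have : Z q = ⋂ f ∈ q, {h | (f : H → ℂ) h = 0} := by
      ext h
      simp only [Set.mem_iInter]
      rfl
    rw [this]
    exact isClosed_biInter fun f _ => isClosed_singleton.preimage (hB.continuous f.2)
  -- The complement is a finite union of closed sets, so `Z p` is clopen and, by connectedness,
  -- everything. Elements of `p` then vanish at every point, and primality of `p` finishes the
  -- argument.
  have hcompl : (Z p)ᶜ = ⋃ q ∈ minimalPrimes B \ {p}, Z q := by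
    ext h
    simp only [Set.mem_compl_iff, Set.mem_iUnion]
    constructor
    · intro hh
      obtain ⟨q, hq, hle⟩ := hexists h
      exact ⟨q, ⟨hq, fun hqp => hh (hqp ▸ hle)⟩, hle⟩
    · rintro ⟨q, ⟨hq, hqp⟩, hle⟩ hh
      exact hqp (le_antisymm (huniq h q hq p hp hle hh) (huniq h p hp q hq hh hle))
  have hclopen : IsClopen (Z p) := by
    refine ⟨hclosed p, ?_⟩
    rw [← isClosed_compl_iff, hcompl]
    exact (hfin.subset Set.sdiff_subset).isClosed_biUnion fun q _ => hclosed q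
  have hne : (Z p).Nonempty := by
    obtain ⟨q, hq, hle⟩ := hexists h₀
    exact ⟨h₀, huniq₀ q hq hle ▸ hle⟩
  have huniv : ∀ h, p ≤ RingHom.ker (ev h) := fun h => by
    have := hclopen.eq_univ hne
    exact (this ▸ Set.mem_univ h : h ∈ Z p)
  have hzero : ∀ f : B, f ∈ p → (f : H → ℂ) = 0 := fun f hf => funext fun h => huniv h hf
  have hmem : (⟨f₁, h₁⟩ * ⟨f₂, h₂⟩ : B) ∈ p := by
    have : (⟨f₁, h₁⟩ * ⟨f₂, h₂⟩ : B) = 0 := Subtype.ext h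
    rw [this]
    exact p.zero_mem
  exact (hpp.mem_or_mem hmem).imp (hzero _) (hzero _)

variable (H) in
/-- The continuous functions that lie in a finitely generated translation invariant algebra. -/
def representativeFunctions [TopologicalSpace H] : Subalgebra ℂ (H → ℂ) where
  carrier := {f | ∃ B, IsTranslationAlgebra B ∧ f ∈ B}
  mul_mem' := by
    rintro f g ⟨B, hB, hf⟩ ⟨B', hB', hg⟩
    exact ⟨B ⊔ B', hB.sup hB', mul_mem ((le_sup_left : B ≤ B ⊔ B') hf)
      ((le_sup_right : B' ≤ B ⊔ B') hg)⟩
  add_mem' := by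
    rintro f g ⟨B, hB, hf⟩ ⟨B', hB', hg⟩
    exact ⟨B ⊔ B', hB.sup hB', add_mem ((le_sup_left : B ≤ B ⊔ B') hf)
      ((le_sup_right : B' ≤ B ⊔ B') hg)⟩
  algebraMap_mem' c := ⟨⊥, ⟨Subalgebra.fg_bot, fun _ => bot_le, bot_le⟩,
    Subalgebra.algebraMap_mem _ c⟩

theorem eq_zero_or_eq_zero_of_mem_representativeFunctions [TopologicalSpace H] [ConnectedSpace H]
    {f g : H → ℂ} (hf : f ∈ representativeFunctions H) (hg : g ∈ representativeFunctions H)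
    (h : f * g = 0) : f = 0 ∨ g = 0 := by
  obtain ⟨B, hB, hf⟩ := hf
  obtain ⟨B', hB', hg⟩ := hg
  exact (hB.sup hB').eq_zero_or_eq_zero ((le_sup_left : B ≤ B ⊔ B') hf)
    ((le_sup_right : B' ≤ B ⊔ B') hg) h

/-- The coefficients of `R` generate a suitable algebra: `R (h * x) = R h * R x` makes a translated
coefficient a linear combination of coefficients in the same column. -/
theorem matrixCoefficient_mem_representativeFunctions [TopologicalSpace H] {A : Type*} [Fintype A]
    [DecidableEq A] (R : H →* Matrix A A ℂ) (hR : Continuous R) (a b : A) :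
    (fun h => R h a b) ∈ representativeFunctions H := by
  let s : Set (H → ℂ) := Set.range fun q : A × A => fun h => R h q.1 q.2
  refine ⟨Algebra.adjoin ℂ s, ⟨⟨(Set.finite_range _ : s.Finite).toFinset, by rw [Set.Finite.coe_toFinset]⟩, ?_, ?_⟩,
    Algebra.subset_adjoin ⟨(a, b), rfl⟩⟩
  · intro h
    refine Algebra.adjoin_le ?_
    rintro _ ⟨q, rfl⟩
    have : leftTranslation h (fun x => R x q.1 q.2) =
        ∑ c, R h q.1 c • fun x => R x c q.2 := by
      ext x
      change R (h * x) q.1 q.2 = _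
      simp [Matrix.mul_apply]
    rw [SetLike.mem_coe, Subalgebra.mem_comap, this]
    exact sum_mem fun c _ => Subalgebra.smul_mem _
      (Algebra.subset_adjoin (show (fun x => R x c q.2) ∈ s from ⟨(c, q.2), rfl⟩)) _
  · refine Algebra.adjoin_le ?_
    rintro _ ⟨q, rfl⟩
    exact hR.matrix_elem q.1 q.2

end RepresentativeFunctions

/-! ### Unitary equivalence of matrix families with equal traces -/

section TraceCharacters

variable {A B : Type*} [Fintype A]

/-- The bilinear form `(x, y) ↦ tr (x y)` of the first components, on a space of pairs. -/
def traceForm (L : Submodule ℂ (Matrix A A ℂ × Matrix B B ℂ)) : LinearMap.BilinForm ℂ L :=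
  LinearMap.mk₂ ℂ (fun x y => (x.1.1 * y.1.1).trace)
    (fun x x' y => by simp [Matrix.add_mul]) (fun c x y => by simp)
    (fun x y y' => by simp [Matrix.mul_add]) (fun c x y => by simp)

theorem traceForm_apply (L : Submodule ℂ (Matrix A A ℂ × Matrix B B ℂ)) (x y : L) :
    traceForm L x y = (x.1.1 * y.1.1).trace := rfl

variable [Fintype B]

/-- Pairing `x` with `star x` gives the squared Hilbert-Schmidt norm of `x.1` and, by `htr`, also
that of `x.2`. -/
theorem traceForm_nondegenerate {L : Submodule ℂ (Matrix A A ℂ × Matrix B B ℂ)}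
    (hstar : ∀ x ∈ L, star x ∈ L)
    (htr : ∀ x ∈ L, ∀ y ∈ L, (x.1 * y.1).trace = (x.2 * y.2).trace) :
    (traceForm L).Nondegenerate := by
  have hrefl : (traceForm L).IsRefl := fun x y h => by
    rw [traceForm_apply] at h ⊢
    rw [trace_mul_comm, h]
  refine (LinearMap.IsRefl.nondegenerate_iff_separatingLeft hrefl).2 fun x hx => ?_
  have h1 := hx ⟨star x.1, hstar _ x.2⟩
  have h2 := h1
  rw [traceForm_apply] at h1 h2
  rw [htr _ x.2 _ (hstar _ x.2)] at h2
  exact Subtype.ext (Prod.ext (trace_mul_conjTranspose_self_eq_zero_iff.1 h1)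
    (trace_mul_conjTranspose_self_eq_zero_iff.1 h2))

/-- A nonzero intertwiner obtained as a Casimir element of the trace form. -/
theorem exists_ne_zero_intertwiner {𝒢 : Set (Matrix A A ℂ × Matrix B B ℂ)}
    {L : Submodule ℂ (Matrix A A ℂ × Matrix B B ℂ)}
    (hstar : ∀ x ∈ L, star x ∈ L)
    (htr : ∀ x ∈ L, ∀ y ∈ L, (x.1 * y.1).trace = (x.2 * y.2).trace)
    (hleft : ∀ g ∈ 𝒢, ∀ x ∈ L, g * x ∈ L) (hright : ∀ g ∈ 𝒢, ∀ x ∈ L, x * g ∈ L)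
    (hne : ∃ x ∈ L, x.1 ≠ 0) :
    ∃ X : Matrix B A ℂ, X ≠ 0 ∧ (∀ g ∈ 𝒢, X * g.1 = g.2 * X) ∧
      (∀ P : Matrix A A ℂ, (∀ x ∈ L, x.1 * P = x.1) → X * P = X) ∧
      ∀ Q : Matrix B B ℂ, (∀ x ∈ L, Q * x.2 = x.2) → Q * X = X := by
  classical
  have hnd := traceForm_nondegenerate hstar htr
  have hsymm : (traceForm L).IsSymm := ⟨fun x y => by
    simp only [traceForm_apply]
    exact trace_mul_comm _ _⟩
  let b := Module.finBasis ℂ L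
  let d := (traceForm L).dualBasis hnd b
  have hb : ∀ y : L, y = ∑ k, traceForm L (d k) y • b k := by
    intro y
    have h := b.sum_repr y
    conv_lhs => rw [← h]
    refine Finset.sum_congr rfl fun k _ => ?_
    congr 1
    conv_rhs => rw [← h]
    simp only [map_sum, map_smul, d, LinearMap.BilinForm.apply_dualBasis_left, smul_eq_mul]
    simp
  have hd : ∀ y : L, y = ∑ k, traceForm L y (b k) • d k := by
    intro y
    conv_lhs => rw [← d.sum_repr y]
    simp only [d, LinearMap.BilinForm.dualBasis_repr_apply]
  have hb' : ∀ y : L, y.1 = ∑ k, traceForm L (d k) y • (b k).1 := fun y => by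
    conv_lhs => rw [hb y]
    simp
  have hd' : ∀ y : L, y.1 = ∑ k, traceForm L y (b k) • (d k).1 := fun y => by
    conv_lhs => rw [hd y]
    simp
  -- The Casimir element of the form, with its first leg represented on `B`, its second on `A`, and
  -- an arbitrary `Z` in between.
  let X : Matrix B A ℂ → Matrix B A ℂ := fun Z => ∑ k, (b k).1.2 * Z * (d k).1.1
  suffices hX : ∃ Z, X Z ≠ 0 by
    obtain ⟨Z, hZ⟩ := hX
    refine ⟨X Z, hZ, fun g hg => ?_, fun P hP => ?_, fun Q hQ => ?_⟩
    · have h1 : ∀ k, (d k).1.1 * g.1 =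
          ∑ j, (traceForm L ⟨(d k).1 * g, hright g hg _ (d k).2⟩ (b j)) • (d j).1.1 := by
        intro k
        have := congrArg Prod.fst (hd' ⟨(d k).1 * g, hright g hg _ (d k).2⟩)
        simpa [Prod.fst_sum] using this
      have h2 : ∀ j, g.2 * (b j).1.2 =
          ∑ k, (traceForm L (d k) ⟨g * (b j).1, hleft g hg _ (b j).2⟩) • (b k).1.2 := by
        intro j
        have := congrArg Prod.snd (hb' ⟨g * (b j).1, hleft g hg _ (b j).2⟩)
        simpa [Prod.snd_sum] using this
      -- Invariance of the trace form, `⟨d g, b⟩ = ⟨d, g b⟩`: this is what moves `g` across the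
      -- Casimir element.
      have h3 : ∀ k j, traceForm L ⟨(d k).1 * g, hright g hg _ (d k).2⟩ (b j) =
          traceForm L (d k) ⟨g * (b j).1, hleft g hg _ (b j).2⟩ := by
        intro k j
        simp only [traceForm_apply, Prod.fst_mul, Matrix.mul_assoc]
      calc X Z * g.1 = ∑ k, (b k).1.2 * Z * ((d k).1.1 * g.1) := by
            simp only [X, Matrix.sum_mul, Matrix.mul_assoc]
        _ = ∑ k, ∑ j, (traceForm L (d k) ⟨g * (b j).1, hleft g hg _ (b j).2⟩) •
              ((b k).1.2 * Z * (d j).1.1) := by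
            refine Finset.sum_congr rfl fun k _ => ?_
            rw [h1, Matrix.mul_sum]
            refine Finset.sum_congr rfl fun j _ => ?_
            rw [h3, Matrix.mul_smul]
        _ = ∑ j, g.2 * (b j).1.2 * Z * (d j).1.1 := by
            rw [Finset.sum_comm]
            refine Finset.sum_congr rfl fun j _ => ?_
            rw [h2, Matrix.sum_mul, Matrix.sum_mul]
            refine Finset.sum_congr rfl fun k _ => ?_
            rw [Matrix.smul_mul, Matrix.smul_mul]
        _ = g.2 * X Z := by
            simp only [X, Matrix.mul_sum, Matrix.mul_assoc]
    · simp only [X, Matrix.sum_mul, Matrix.mul_assoc, hP _ (d _).2]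
    · simp only [X, Matrix.mul_sum, ← Matrix.mul_assoc, hQ _ (b _).2]
  -- If `X Z = 0` for all matrix units `Z`, the tensor `∑ (b k).2 ⊗ (d k).1` vanishes. Contracting
  -- it with `y.2`, and using that both components have the same traces, yields the expansion of
  -- `y.1` in the dual basis, so `y.1 = 0`.
  by_contra hcon
  push Not at hcon
  obtain ⟨y, hy, hy0⟩ := hne
  apply hy0
  have hy' := congrArg Prod.fst (hd' ⟨y, hy⟩)
  simp only [Prod.fst_sum, Prod.smul_fst] at hy'
  rw [hy']
  ext r s
  have hentry : ∀ p q, ∑ k, (b k).1.2 p q * (d k).1.1 r s = 0 := by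
    intro p q
    have := congrFun (congrFun (hcon (Matrix.single q r 1)) p) s
    simpa [X, Matrix.sum_apply, Matrix.mul_apply, Matrix.single_apply, Finset.sum_ite_eq,
      ite_and] using this
  have htr' : ∀ k, traceForm L ⟨y, hy⟩ (b k) = ∑ q, ∑ p, y.2 q p * (b k).1.2 p q := by
    intro k
    rw [traceForm_apply, htr _ hy _ (b k).2]
    simp [Matrix.trace, Matrix.mul_apply]
  calc (∑ k, traceForm L ⟨y, hy⟩ (b k) • (d k).1.1) r s
      = ∑ k, ∑ q, ∑ p, y.2 q p * ((b k).1.2 p q * (d k).1.1 r s) := by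
        simp only [Matrix.sum_apply, Matrix.smul_apply, htr', smul_eq_mul, Finset.sum_mul,
          mul_assoc]
    _ = ∑ q, ∑ p, y.2 q p * ∑ k, (b k).1.2 p q * (d k).1.1 r s := by
        rw [Finset.sum_comm]
        refine Finset.sum_congr rfl fun q _ => ?_
        rw [Finset.sum_comm]
        refine Finset.sum_congr rfl fun p _ => ?_
        rw [Finset.mul_sum]
    _ = (0 : Matrix A A ℂ) r s := by simp [hentry]

/-- The partial isometry in the polar decomposition of a matrix. -/
theorem exists_polar_partialIsometry [DecidableEq A] (X : Matrix B A ℂ) (hX : X ≠ 0) :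
    ∃ F : Matrix A A ℂ, X * F ≠ 0 ∧ (X * F) * (X * F)ᴴ * (X * F) = X * F ∧
      ∀ M : Matrix A A ℂ, Commute (Xᴴ * X) M → Commute F M := by
  set D : Matrix A A ℂ := Xᴴ * X with hD
  have hDh : D.IsHermitian := isHermitian_conjTranspose_mul_self X
  have hDs : IsSelfAdjoint D := hDh
  have hpos : ∀ x ∈ spectrum ℝ D, 0 ≤ x := by
    have hps : D.PosSemidef := posSemidef_conjTranspose_mul_self X
    intro x hx
    rw [hDh.spectrum_real_eq_range_eigenvalues] at hx
    obtain ⟨i, rfl⟩ := hx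
    exact hps.eigenvalues_nonneg i
  have hc : ∀ f : ℝ → ℝ, ContinuousOn f (spectrum ℝ D) := fun f =>
    (finite_real_spectrum (A := D)).continuousOn f
  -- `F` is the inverse square root of `Xᴴ * X` on its support and zero on the kernel, because the
  -- inverse of `0` is `0` here.
  let f : ℝ → ℝ := fun x => (Real.sqrt x)⁻¹
  have hFh : (cfc f D)ᴴ = cfc f D := cfc_predicate f D
  have hmul : ∀ g h : ℝ → ℝ, cfc g D * cfc h D = cfc (fun x => g x * h x) D := fun g h =>
    (cfc_mul g h D (hc g) (hc h)).symm
  have hid : cfc (fun x : ℝ => x) D = D := cfc_id' ℝ D hDs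
  have hDmul : ∀ g : ℝ → ℝ, D * cfc g D = cfc (fun x => x * g x) D := fun g => by
    have := hmul (fun x => x) g
    rwa [hid] at this
  refine ⟨cfc f D, fun h0 => hX ?_, ?_, fun M hM => hM.cfc_real f⟩
  · have h1 : D * cfc f D = 0 := by rw [hD, Matrix.mul_assoc, h0, Matrix.mul_zero]
    have h2 : D = 0 := by
      have h3 : D * cfc f D * (D * cfc f D) = D := by
        rw [hDmul, hmul]
        conv_rhs => rw [← hid]
        refine cfc_congr fun x hx => ?_
        have hx0 := hpos x hx
        rcases hx0.eq_or_lt with rfl | hx0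
        · simp
        · have := Real.sqrt_pos.2 hx0
          have h4 := Real.mul_self_sqrt hx0.le
          simp only [f]
          field_simp
          nlinarith
      rw [← h3, h1, Matrix.mul_zero]
    exact conjTranspose_mul_self_eq_zero.1 h2
  · have h1 : cfc f D * D * cfc f D = cfc (fun x => f x * x * f x) D := by
      rw [Matrix.mul_assoc, hDmul, hmul]
      simp only [mul_assoc]
    rw [conjTranspose_mul, hFh]
    calc X * cfc f D * (cfc f D * Xᴴ) * (X * cfc f D)
        = X * (cfc f D * (cfc f D * D * cfc f D)) := by
          simp only [hD, Matrix.mul_assoc]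
      _ = X * cfc f D := by
          rw [h1, hmul]
          congr 1
          refine cfc_congr fun x hx => ?_
          have hx0 := hpos x hx
          rcases hx0.eq_or_lt with rfl | hx0
          · simp [f]
          · have := Real.sqrt_pos.2 hx0
            have h4 := Real.mul_self_sqrt hx0.le
            simp only [f]
            field_simp
            nlinarith

/-- Two star-closed families of matrices with equal traces on a two-sided ideal `L` are unitarily
equivalent on the parts of the spaces on which `L` acts nondegenerately. -/
theorem exists_partialIsometry_of_trace_eq [DecidableEq A] [DecidableEq B]
    {𝒢 : Set (Matrix A A ℂ × Matrix B B ℂ)} {L : Submodule ℂ (Matrix A A ℂ × Matrix B B ℂ)}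
    (h𝒢 : ∀ g ∈ 𝒢, star g ∈ 𝒢) (hstar : ∀ x ∈ L, star x ∈ L) (hL : (L : Set _) ⊆ 𝒢)
    (hleft : ∀ g ∈ 𝒢, ∀ x ∈ L, g * x ∈ L) (hright : ∀ g ∈ 𝒢, ∀ x ∈ L, x * g ∈ L)
    (htr : ∀ x ∈ L, x.1.trace = x.2.trace) :
    ∃ V : Matrix B A ℂ, V * Vᴴ * V = V ∧ (∀ g ∈ 𝒢, V * g.1 = g.2 * V) ∧
      ∀ x ∈ L, Vᴴ * V * x.1 = x.1 ∧ V * Vᴴ * x.2 = x.2 := by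
  let 𝒱 : Set (Matrix B A ℂ) := {V | V * Vᴴ * V = V ∧ ∀ g ∈ 𝒢, V * g.1 = g.2 * V}
  -- An intertwining partial isometry with minimal kernel, that is, one that cannot be extended.
  obtain ⟨V, ⟨hV, hVg⟩, hmin⟩ := (InvImage.wf (fun V : Matrix B A ℂ => LinearMap.ker V.mulVecLin)
    wellFounded_lt).has_min 𝒱 ⟨0, by simp [𝒱]⟩
  have hVadj : ∀ X : Matrix B A ℂ, (∀ g ∈ 𝒢, X * g.1 = g.2 * X) →
      ∀ g ∈ 𝒢, Xᴴ * g.2 = g.1 * Xᴴ := by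
    intro X hX g hg
    have := congrArg conjTranspose (hX _ (h𝒢 g hg))
    simpa [conjTranspose_mul, star_eq_conjTranspose] using this.symm
  have hVg' := hVadj V hVg
  set P : Matrix A A ℂ := 1 - Vᴴ * V with hP
  set Q : Matrix B B ℂ := 1 - V * Vᴴ with hQ
  have hV' : Vᴴ * V * Vᴴ = Vᴴ := by
    simpa [conjTranspose_mul, Matrix.mul_assoc] using congrArg conjTranspose hV
  have hPP : P * P = P := by
    have : Vᴴ * V * (Vᴴ * V) = Vᴴ * V := by rw [← Matrix.mul_assoc, hV']
    simp only [hP, Matrix.sub_mul, Matrix.mul_sub, Matrix.one_mul, Matrix.mul_one, this]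
    abel
  have hQQ : Q * Q = Q := by
    have : V * Vᴴ * (V * Vᴴ) = V * Vᴴ := by rw [← Matrix.mul_assoc, hV]
    simp only [hQ, Matrix.sub_mul, Matrix.mul_sub, Matrix.one_mul, Matrix.mul_one, this]
    abel
  have hPh : Pᴴ = P := by simp [hP, conjTranspose_mul]
  have hQh : Qᴴ = Q := by simp [hQ, conjTranspose_mul]
  have hPg : ∀ g ∈ 𝒢, P * g.1 = g.1 * P := by
    intro g hg
    simp only [hP, Matrix.sub_mul, Matrix.mul_sub, Matrix.one_mul, Matrix.mul_one,
      Matrix.mul_assoc, hVg g hg]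
    rw [← Matrix.mul_assoc Vᴴ, hVg' g hg, Matrix.mul_assoc]
  have hQg : ∀ g ∈ 𝒢, Q * g.2 = g.2 * Q := by
    intro g hg
    simp only [hQ, Matrix.sub_mul, Matrix.mul_sub, Matrix.one_mul, Matrix.mul_one,
      Matrix.mul_assoc, hVg' g hg]
    rw [← Matrix.mul_assoc V, hVg g hg, Matrix.mul_assoc]
  have hVP : V * P = 0 := by
    rw [hP, Matrix.mul_sub, Matrix.mul_one, ← Matrix.mul_assoc, hV, sub_self]
  have hVQ : Vᴴ * Q = 0 := by
    rw [hQ, Matrix.mul_sub, Matrix.mul_one, ← Matrix.mul_assoc, hV', sub_self]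
  -- The parts of `x.1` and `x.2` already matched by `V` have equal traces, so the traces on the
  -- complements `P` and `Q` agree as well.
  have hPQtr : ∀ x ∈ L, (x.1 * P).trace = (x.2 * Q).trace := by
    intro x hx
    simp only [hP, hQ, Matrix.mul_sub, Matrix.mul_one, trace_sub, htr x hx]
    rw [← Matrix.mul_assoc, trace_mul_comm, ← Matrix.mul_assoc, hVg x (hL hx), Matrix.mul_assoc]
  -- the restriction of `L` to the complements
  let φ : (Matrix A A ℂ × Matrix B B ℂ) →ₗ[ℂ] (Matrix A A ℂ × Matrix B B ℂ) :=
    LinearMap.mulRight ℂ (P, Q)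
  have hφ : ∀ x, φ x = (x.1 * P, x.2 * Q) := fun x => rfl
  let L' := L.map φ
  have hL' : ∀ x ∈ L, (x.1 * P, x.2 * Q) ∈ L' := fun x hx => ⟨x, hx, hφ x⟩
  have hstar' : ∀ x ∈ L', star x ∈ L' := by
    rintro _ ⟨x, hx, rfl⟩
    have := hL' _ (hstar x hx)
    convert this using 1
    rw [hφ]
    refine Prod.ext ?_ ?_
    · have h1 := hPg _ (hL (hstar x hx))
      simp only [Prod.fst_star, star_eq_conjTranspose, conjTranspose_mul, hPh] at h1 ⊢
      exact h1
    · have h1 := hQg _ (hL (hstar x hx))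
      simp only [Prod.snd_star, star_eq_conjTranspose, conjTranspose_mul, hQh] at h1 ⊢
      exact h1
  have htr' : ∀ x ∈ L', ∀ y ∈ L', (x.1 * y.1).trace = (x.2 * y.2).trace := by
    rintro _ ⟨x, hx, rfl⟩ _ ⟨y, hy, rfl⟩
    have h1 : x.1 * P * (y.1 * P) = (x * y).1 * P := by
      rw [Prod.fst_mul, Matrix.mul_assoc, ← Matrix.mul_assoc P, hPg y (hL hy),
        Matrix.mul_assoc y.1, hPP, Matrix.mul_assoc]
    have h2 : x.2 * Q * (y.2 * Q) = (x * y).2 * Q := by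
      rw [Prod.snd_mul, Matrix.mul_assoc, ← Matrix.mul_assoc Q, hQg y (hL hy),
        Matrix.mul_assoc y.2, hQQ, Matrix.mul_assoc]
    rw [hφ, hφ, h1, h2]
    exact hPQtr _ (hleft x (hL hx) y hy)
  have hleft' : ∀ g ∈ 𝒢, ∀ x ∈ L', g * x ∈ L' := by
    rintro g hg _ ⟨x, hx, rfl⟩
    refine ⟨g * x, hleft g hg x hx, ?_⟩
    rw [hφ, hφ]
    exact Prod.ext (Matrix.mul_assoc _ _ _) (Matrix.mul_assoc _ _ _)
  have hright' : ∀ g ∈ 𝒢, ∀ x ∈ L', x * g ∈ L' := by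
    rintro g hg _ ⟨x, hx, rfl⟩
    refine ⟨x * g, hright g hg x hx, ?_⟩
    rw [hφ, hφ]
    refine Prod.ext ?_ ?_
    · change x.1 * g.1 * P = x.1 * P * g.1
      rw [Matrix.mul_assoc, Matrix.mul_assoc, hPg g hg]
    · change x.2 * g.2 * Q = x.2 * Q * g.2
      rw [Matrix.mul_assoc, Matrix.mul_assoc, hQg g hg]
  -- If `L` still acted on the complement, the Casimir intertwiner there would have a polar part `Y`
  -- orthogonal to `V` on both sides, and `V + Y` would have a smaller kernel.
  have hzero : ∀ x ∈ L, x.1 * P = 0 := by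
    by_contra! hcon
    obtain ⟨x, hx, hx0⟩ := hcon
    obtain ⟨X, hX0, hXg, hXP, hXQ⟩ := exists_ne_zero_intertwiner hstar' htr' hleft' hright'
      ⟨_, hL' x hx, hx0⟩
    have hXP := hXP P (by
      rintro _ ⟨y, hy, rfl⟩
      change y.1 * P * P = y.1 * P
      rw [Matrix.mul_assoc, hPP])
    have hXQ := hXQ Q (by
      rintro _ ⟨y, hy, rfl⟩
      change Q * (y.2 * Q) = y.2 * Q
      rw [← Matrix.mul_assoc, hQg y (hL hy), Matrix.mul_assoc, hQQ])
    obtain ⟨F, hF0, hFiso, hFcomm⟩ := exists_polar_partialIsometry X hX0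
    have hXg' := hVadj X hXg
    have hFg : ∀ g ∈ 𝒢, F * g.1 = g.1 * F := fun g hg => hFcomm _ (by
      change Xᴴ * X * g.1 = g.1 * (Xᴴ * X)
      rw [Matrix.mul_assoc, hXg g hg, ← Matrix.mul_assoc, hXg' g hg, Matrix.mul_assoc])
    have hFP : F * P = P * F := hFcomm _ (by
      have h1 : P * Xᴴ = Xᴴ := by simpa [conjTranspose_mul, hPh] using congrArg conjTranspose hXP
      change Xᴴ * X * P = P * (Xᴴ * X)
      rw [Matrix.mul_assoc, hXP, ← Matrix.mul_assoc, h1])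
    set Y := X * F with hY
    have hYP : Y * P = Y := by rw [hY, Matrix.mul_assoc, hFP, ← Matrix.mul_assoc, hXP]
    have hYQ : Q * Y = Y := by rw [hY, ← Matrix.mul_assoc, hXQ]
    have hVY : Vᴴ * Y = 0 := by rw [← hYQ, ← Matrix.mul_assoc, hVQ, Matrix.zero_mul]
    have hYV : Yᴴ * V = 0 := by
      simpa [conjTranspose_mul] using congrArg conjTranspose hVY
    have hPY : P * Yᴴ = Yᴴ := by simpa [conjTranspose_mul, hPh] using congrArg conjTranspose hYP
    have hVYh : V * Yᴴ = 0 := by rw [← hPY, ← Matrix.mul_assoc, hVP, Matrix.zero_mul]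
    have hYVh : Y * Vᴴ = 0 := by
      simpa [conjTranspose_mul] using congrArg conjTranspose hVYh
    have hmem : V + Y ∈ 𝒱 := by
      refine ⟨?_, fun g hg => ?_⟩
      · simp only [conjTranspose_add, Matrix.add_mul, Matrix.mul_add, hVYh, hYVh, hV, hFiso,
          add_zero, zero_add]
        rw [Matrix.mul_assoc Y, hYV, Matrix.mul_assoc V, hVY]
        simp
      · rw [Matrix.add_mul, Matrix.mul_add, hVg g hg, hY, Matrix.mul_assoc, hFg g hg,
          ← Matrix.mul_assoc, hXg g hg, Matrix.mul_assoc]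
    refine hmin _ hmem ?_
    have hker : ∀ u, (V + Y) *ᵥ u = 0 → V *ᵥ u = 0 := by
      intro u hu
      have h1 : Vᴴ * (V + Y) = Vᴴ * V := by rw [Matrix.mul_add, hVY, add_zero]
      have h2 : V * Vᴴ * (V + Y) = V := by rw [Matrix.mul_assoc, h1, ← Matrix.mul_assoc, hV]
      rw [← h2, ← Matrix.mulVec_mulVec, hu, Matrix.mulVec_zero]
    refine SetLike.lt_iff_le_and_exists.2 ⟨fun u hu => hker u hu, ?_⟩
    obtain ⟨u, hu⟩ : ∃ u, Y *ᵥ u ≠ 0 := by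
      by_contra! hcon
      exact hF0 (Matrix.ext_of_mulVec_single fun i => by
        rw [hcon, Matrix.zero_mulVec])
    -- This vector lies in the initial space of `Y`: `V` kills it, while `V + Y` sends it to `Y *ᵥ
    -- u`, which is not zero.
    refine ⟨(Yᴴ * Y) *ᵥ u, ?_, fun hmem => hu ?_⟩
    · change V *ᵥ ((Yᴴ * Y) *ᵥ u) = 0
      rw [Matrix.mulVec_mulVec, ← Matrix.mul_assoc, hVYh]
      simp
    · have : (V + Y) *ᵥ ((Yᴴ * Y) *ᵥ u) = 0 := hmem
      rwa [Matrix.mulVec_mulVec, ← Matrix.mul_assoc, Matrix.add_mul, hVYh, zero_add,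
        hFiso] at this
  have hzero2 : ∀ x ∈ L, x.2 * Q = 0 := by
    intro x hx
    have h1 := htr' _ (hL' x hx) _ (hstar' _ (hL' x hx))
    rw [Prod.fst_star, hzero x hx] at h1
    simp only [Matrix.zero_mul, trace_zero, Prod.snd_star] at h1
    exact trace_mul_conjTranspose_self_eq_zero_iff.1 h1.symm
  refine ⟨V, hV, hVg, fun x hx => ⟨?_, ?_⟩⟩
  · have := hzero x hx
    rw [← hPg x (hL hx), hP, Matrix.sub_mul, Matrix.one_mul, sub_eq_zero] at this
    exact this.symm
  · have := hzero2 x hx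
    rw [← hQg x (hL hx), hQ, Matrix.sub_mul, Matrix.one_mul, sub_eq_zero] at this
    exact this.symm

end TraceCharacters

/-! ### Words in a state and a unitary representation -/

section Words

variable {G A B C : Type*} [Fintype A] [Fintype B] [Fintype C] [DecidableEq A] [DecidableEq B]
  [DecidableEq C]

/-- The product of a word in the letters `ρ` (written `none`) and `w g` (written `some g`). -/
def wordProd (w : G → Matrix A A ℂ) (ρ : Matrix A A ℂ) (l : List (Option G)) : Matrix A A ℂ :=
  (l.map fun o => o.elim ρ w).prod

@[simp]
theorem wordProd_nil (w : G → Matrix A A ℂ) (ρ : Matrix A A ℂ) : wordProd w ρ [] = 1 := rfl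

theorem wordProd_cons (w : G → Matrix A A ℂ) (ρ : Matrix A A ℂ) (o : Option G)
    (l : List (Option G)) : wordProd w ρ (o :: l) = o.elim ρ w * wordProd w ρ l := by
  simp [wordProd]

theorem wordProd_append (w : G → Matrix A A ℂ) (ρ : Matrix A A ℂ) (l l' : List (Option G)) :
    wordProd w ρ (l ++ l') = wordProd w ρ l * wordProd w ρ l' := by
  simp [wordProd]

theorem wordProd_conjTranspose [Group G] (W : G →* unitaryGroup A ℂ) {ρ : Matrix A A ℂ}
    (hρ : ρ.IsHermitian) (l : List (Option G)) :
    (wordProd (fun g => (W g : Matrix A A ℂ)) ρ l)ᴴ =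
      wordProd (fun g => (W g : Matrix A A ℂ)) ρ (l.map (Option.map (·⁻¹))).reverse := by
  induction l with
  | nil => simp
  | cons o l ih =>
    rw [wordProd_cons, conjTranspose_mul, ih, List.map_cons, List.reverse_cons, wordProd_append]
    congr 1
    rw [wordProd_cons, wordProd_nil, Matrix.mul_one]
    cases o with
    | none => exact hρ
    | some g => simp [star_eq_conjTranspose]

theorem wordProd_kronecker (w : G → Matrix A A ℂ) (w' : G → Matrix C C ℂ) (ρ : Matrix A A ℂ)
    (σ : Matrix C C ℂ) (l : List (Option G)) :
    wordProd (fun g => w g ⊗ₖ w' g) (ρ ⊗ₖ σ) l = wordProd w ρ l ⊗ₖ wordProd w' σ l := by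
  induction l with
  | nil => simp
  | cons o l ih =>
    rw [wordProd_cons, wordProd_cons, wordProd_cons, mul_kronecker_mul, ih]
    cases o <;> rfl

theorem wordProd_one (ρ : Matrix A A ℂ) (l : List (Option G)) :
    ∃ k, wordProd (fun _ => 1) ρ l = ρ ^ k := by
  induction l with
  | nil => exact ⟨0, by simp⟩
  | cons o l ih =>
    obtain ⟨k, hk⟩ := ih
    rw [wordProd_cons, hk]
    cases o with
    | none => exact ⟨k + 1, (pow_succ' ρ k).symm⟩
    | some g => exact ⟨k, by simp⟩

theorem mul_wordProd {w : G → Matrix A A ℂ} {w' : G → Matrix B B ℂ} {ρ : Matrix A A ℂ}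
    {τ : Matrix B B ℂ} {K : Matrix B A ℂ} (hw : ∀ g, K * w g = w' g * K) (hρ : K * ρ = τ * K)
    (l : List (Option G)) : K * wordProd w ρ l = wordProd w' τ l * K := by
  induction l with
  | nil => simp
  | cons o l ih =>
    rw [wordProd_cons, wordProd_cons, Matrix.mul_assoc, ← ih]
    cases o with
    | none => simp only [Option.elim_none, ← Matrix.mul_assoc, hρ]
    | some g => simp only [Option.elim_some, ← Matrix.mul_assoc, hw]

/-- An isometry that intertwines the letters preserves the traces of the words that contain the
state; a unitary preserves all of them. -/
theorem trace_wordProd_eq_of_isometry {w : G → Matrix A A ℂ} {w' : G → Matrix B B ℂ}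
    {ρ : Matrix A A ℂ} {τ : Matrix B B ℂ} {K : Matrix B A ℂ} (hK : Kᴴ * K = 1)
    (hw : ∀ g, K * w g = w' g * K) (hρ : K * ρ * Kᴴ = τ) {l : List (Option G)}
    (hl : none ∈ l ∨ K * Kᴴ = 1) : (wordProd w ρ l).trace = (wordProd w' τ l).trace := by
  have hρ' : K * ρ = τ * K := by
    rw [← hρ, Matrix.mul_assoc, hK, Matrix.mul_one]
  have key := mul_wordProd hw hρ'
  -- Moving a word through `K` leaves the range projection `K * Kᴴ` behind. It disappears if `K` is
  -- unitary, or if a letter `τ`, whose range lies in that of `K`, can be rotated next to it.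
  have hconj : ∀ l, (wordProd w ρ l).trace = (wordProd w' τ l * (K * Kᴴ)).trace := by
    intro l
    rw [← Matrix.mul_assoc, ← key, trace_mul_comm, ← Matrix.mul_assoc, hK, Matrix.one_mul]
  rcases hl with hl | hl
  · obtain ⟨l₁, l₂, rfl⟩ := List.append_of_mem hl
    rw [hconj, wordProd_append, wordProd_cons, Option.elim_none]
    have h1 : wordProd w' τ l₁ * τ = K * (wordProd w ρ l₁ * ρ * Kᴴ) := by
      calc wordProd w' τ l₁ * τ = wordProd w' τ l₁ * K * (ρ * Kᴴ) := by
            rw [Matrix.mul_assoc, ← Matrix.mul_assoc K, hρ]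
        _ = K * (wordProd w ρ l₁ * ρ * Kᴴ) := by
            rw [← key]
            simp only [Matrix.mul_assoc]
    have h2 : K * Kᴴ * (wordProd w' τ l₁ * τ) = wordProd w' τ l₁ * τ := by
      rw [h1, Matrix.mul_assoc K, ← Matrix.mul_assoc Kᴴ, hK, Matrix.one_mul]
    rw [trace_mul_comm, ← Matrix.mul_assoc (wordProd w' τ l₁), ← Matrix.mul_assoc, h2]
  · rw [hconj, hl, Matrix.mul_one]

/-- A positive semidefinite matrix of trace zero vanishes, and a Hermitian nilpotent matrix
vanishes, as repeated halving of exponents `2 ^ n` shows. -/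
theorem pow_trace_ne_zero {σ : Matrix C C ℂ} (hσ : IsDensityMatrix σ) (k : ℕ) :
    (σ ^ k).trace ≠ 0 := by
  intro h
  have h0 : σ ^ k = 0 := (hσ.1.pow k).trace_eq_zero_iff.1 h
  have key : ∀ n, σ ^ 2 ^ n = 0 → σ = 0 := by
    intro n
    induction n with
    | zero => simp
    | succ n ih =>
      intro hn
      refine ih (conjTranspose_mul_self_eq_zero.1 ?_)
      rw [(hσ.1.1.pow _).eq, ← pow_add, ← two_mul, ← pow_succ', hn]
  have hσ0 : σ = 0 := key k (pow_eq_zero_of_le Nat.lt_two_pow_self.le h0)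
  have := hσ.2
  simp [hσ0] at this

/-- The letter `some i` is a variable with value `f i`, so a word becomes a function on the product
group `G → G`, which is connected whenever `G` is. One group serves words of every length. -/
theorem trace_wordProd_mem_representativeFunctions [Group G] [TopologicalSpace G]
    {W : G →* unitaryGroup A ℂ} (hW : Continuous W) (ρ : Matrix A A ℂ) (l : List (Option G)) :
    (fun f : G → G => (wordProd (fun i => (W (f i) : Matrix A A ℂ)) ρ l).trace) ∈
      representativeFunctions (G → G) := by
  have key : ∀ a b, (fun f : G → G => wordProd (fun i => (W (f i) : Matrix A A ℂ)) ρ l a b) ∈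
      representativeFunctions (G → G) := by
    induction l with
    | nil => exact fun a b => Subalgebra.algebraMap_mem _ ((1 : Matrix A A ℂ) a b)
    | cons o l ih =>
      intro a b
      have : (fun f : G → G => wordProd (fun i => (W (f i) : Matrix A A ℂ)) ρ (o :: l) a b) =
          ∑ c, (fun f : G → G => (o.elim ρ fun i => (W (f i) : Matrix A A ℂ)) a c) *
            fun f : G → G => wordProd (fun i => (W (f i) : Matrix A A ℂ)) ρ l c b := by
        ext f
        simp [wordProd_cons, Matrix.mul_apply]
      rw [this]
      refine sum_mem fun c _ => mul_mem ?_ (ih c b)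
      cases o with
      | none => exact Subalgebra.algebraMap_mem _ (ρ a c)
      | some i =>
        exact matrixCoefficient_mem_representativeFunctions
          (((unitaryGroup A ℂ).subtype.comp W).comp (Pi.evalMonoidHom (fun _ : G => G) i))
          (continuous_subtype_val.comp (hW.comp (continuous_apply i))) a c
  have : (fun f : G → G => (wordProd (fun i => (W (f i) : Matrix A A ℂ)) ρ l).trace) =
      ∑ a, fun f : G → G => wordProd (fun i => (W (f i) : Matrix A A ℂ)) ρ l a a := by
    ext f
    simp [Matrix.trace]
  rw [this]
  exact sum_mem fun a _ => key a a

variable [Group G] [TopologicalSpace G] [ConnectedSpace G]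

/-- Cancels the catalyst trace from the product identity. The absence of zero divisors is essential,
since the catalyst trace may vanish at individual group elements. -/
theorem trace_wordProd_eq_of_catalysis {WA : G →* unitaryGroup A ℂ} {WB : G →* unitaryGroup B ℂ}
    {WC : G →* unitaryGroup C ℂ} (hWA : Continuous WA) (hWB : Continuous WB)
    (hWC : Continuous WC) {ρ : Matrix A A ℂ} {τ : Matrix B B ℂ} {σ : Matrix C C ℂ}
    (hσ : IsDensityMatrix σ) {K : Matrix (B × C) (A × C) ℂ} (hK : Kᴴ * K = 1)
    (hKW : ∀ g, K * ((WA g : Matrix A A ℂ) ⊗ₖ (WC g : Matrix C C ℂ)) =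
      ((WB g : Matrix B B ℂ) ⊗ₖ (WC g : Matrix C C ℂ)) * K)
    (hKρ : K * (ρ ⊗ₖ σ) * Kᴴ = τ ⊗ₖ σ) {l : List (Option G)} (hl : none ∈ l ∨ K * Kᴴ = 1) :
    (wordProd (fun g => (WA g : Matrix A A ℂ)) ρ l).trace =
      (wordProd (fun g => (WB g : Matrix B B ℂ)) τ l).trace := by
  let F : (G → G) → ℂ := (fun f => (wordProd (fun i => (WA (f i) : Matrix A A ℂ)) ρ l).trace) -
    fun f => (wordProd (fun i => (WB (f i) : Matrix B B ℂ)) τ l).trace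
  let h : (G → G) → ℂ := fun f => (wordProd (fun i => (WC (f i) : Matrix C C ℂ)) σ l).trace
  have hFh : F * h = 0 := by
    ext f
    have := trace_wordProd_eq_of_isometry hK (fun i => hKW (f i)) hKρ hl
    rw [wordProd_kronecker, wordProd_kronecker, trace_kronecker, trace_kronecker] at this
    simp only [F, h, Pi.mul_apply, Pi.sub_apply, Pi.zero_apply, sub_mul, this, sub_self]
  rcases eq_zero_or_eq_zero_of_mem_representativeFunctions
    (sub_mem (trace_wordProd_mem_representativeFunctions hWA ρ l)
      (trace_wordProd_mem_representativeFunctions hWB τ l))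
    (trace_wordProd_mem_representativeFunctions hWC σ l) hFh with h0 | h0
  -- At `f = id` the variables take back their own labels. In the other case, the point `f = 1`
  -- turns the catalyst word into a power of `σ`.
  · exact sub_eq_zero.1 (congrFun h0 id)
  · exfalso
    obtain ⟨k, hk⟩ := wordProd_one σ l
    have h1 := congrFun h0 1
    simp only [Pi.one_apply, map_one, OneMemClass.coe_one, hk, Pi.zero_apply] at h1
    exact pow_trace_ne_zero hσ k h1

/-- A catalyst that is returned uncorrelated can be dispensed with, for isometric dynamics. -/
theorem exists_partialIsometry_of_catalysis {WA : G →* unitaryGroup A ℂ}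
    {WB : G →* unitaryGroup B ℂ} {WC : G →* unitaryGroup C ℂ} (hWA : Continuous WA)
    (hWB : Continuous WB) (hWC : Continuous WC) {ρ : Matrix A A ℂ} {τ : Matrix B B ℂ}
    {σ : Matrix C C ℂ} (hρ : ρ.IsHermitian) (hτ : τ.IsHermitian) (hσ : IsDensityMatrix σ)
    {K : Matrix (B × C) (A × C) ℂ} (hK : Kᴴ * K = 1)
    (hKW : ∀ g, K * ((WA g : Matrix A A ℂ) ⊗ₖ (WC g : Matrix C C ℂ)) =
      ((WB g : Matrix B B ℂ) ⊗ₖ (WC g : Matrix C C ℂ)) * K)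
    (hKρ : K * (ρ ⊗ₖ σ) * Kᴴ = τ ⊗ₖ σ) :
    ∃ V : Matrix B A ℂ, V * Vᴴ * V = V ∧
      (∀ g, V * (WA g : Matrix A A ℂ) = (WB g : Matrix B B ℂ) * V) ∧ V * ρ * Vᴴ = τ ∧
      Vᴴ * V * ρ = ρ ∧ (K * Kᴴ = 1 → Vᴴ * V = 1) := by
  let wp : List (Option G) → Matrix A A ℂ × Matrix B B ℂ := fun l =>
    (wordProd (fun g => (WA g : Matrix A A ℂ)) ρ l, wordProd (fun g => (WB g : Matrix B B ℂ)) τ l)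
  -- For a mere isometry, the ideal of words that contain the state. For a unitary, all words, so
  -- that the empty word lies in `L` and forces `Vᴴ * V = 1`.
  let L : Submodule ℂ (Matrix A A ℂ × Matrix B B ℂ) :=
    Submodule.span ℂ (wp '' {l | none ∈ l ∨ K * Kᴴ = 1})
  have hwpL : ∀ l, (none ∈ l ∨ K * Kᴴ = 1) → wp l ∈ L := fun l hl =>
    Submodule.subset_span ⟨l, hl, rfl⟩
  have hmul : ∀ l l', wp l * wp l' = wp (l ++ l') := fun l l' =>
    Prod.ext (wordProd_append _ _ _ _).symm (wordProd_append _ _ _ _).symm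
  have hstar : ∀ l, star (wp l) = wp (l.map (Option.map (·⁻¹))).reverse := fun l =>
    Prod.ext (wordProd_conjTranspose WA hρ l) (wordProd_conjTranspose WB hτ l)
  have hleft : ∀ l, ∀ x ∈ L, wp l * x ∈ L := by
    intro l
    have : L ≤ L.comap (LinearMap.mulLeft ℂ (wp l)) := by
      refine Submodule.span_le.2 ?_
      rintro _ ⟨l', hl', rfl⟩
      change wp l * wp l' ∈ L
      rw [hmul]
      exact hwpL _ (hl'.imp_left fun h => List.mem_append_right _ h)
    exact this
  have hright : ∀ l, ∀ x ∈ L, x * wp l ∈ L := by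
    intro l
    have : L ≤ L.comap (LinearMap.mulRight ℂ (wp l)) := by
      refine Submodule.span_le.2 ?_
      rintro _ ⟨l', hl', rfl⟩
      change wp l' * wp l ∈ L
      rw [hmul]
      exact hwpL _ (hl'.imp_left fun h => List.mem_append_left _ h)
    exact this
  have hLL : ∀ x ∈ L, ∀ y ∈ L, x * y ∈ L := by
    intro x hx
    have : L ≤ L.comap (LinearMap.mulLeft ℂ x) := by
      refine Submodule.span_le.2 ?_
      rintro _ ⟨l', hl', rfl⟩
      exact hright l' x hx
    exact this
  have hstarL : ∀ x ∈ L, star x ∈ L := by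
    intro x hx
    induction hx using Submodule.span_induction with
    | mem x hx =>
      obtain ⟨l, hl, rfl⟩ := hx
      rw [hstar]
      refine hwpL _ (hl.imp_left fun h => List.mem_reverse.2 (List.mem_map.2 ⟨none, h, rfl⟩))
    | zero => simp
    | add x y _ _ hx hy => rw [star_add]; exact add_mem hx hy
    | smul c x _ hx => rw [star_smul]; exact Submodule.smul_mem _ _ hx
  have htr : ∀ x ∈ L, x.1.trace = x.2.trace := by
    intro x hx
    induction hx using Submodule.span_induction with
    | mem x hx =>
      obtain ⟨l, hl, rfl⟩ := hx
      exact trace_wordProd_eq_of_catalysis hWA hWB hWC hσ hK hKW hKρ hl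
    | zero => simp
    | add x y _ _ hx hy => rw [Prod.fst_add, Prod.snd_add, trace_add, trace_add, hx, hy]
    | smul c x _ hx => rw [Prod.smul_fst, Prod.smul_snd, trace_smul, trace_smul, hx]
  obtain ⟨V, hV, hVg, hVL⟩ := exists_partialIsometry_of_trace_eq (𝒢 := Set.range wp ∪ L) (L := L)
    (by
      rintro _ (⟨l, rfl⟩ | hx)
      · exact Or.inl ⟨_, (hstar l).symm⟩
      · exact Or.inr (hstarL _ hx))
    hstarL Set.subset_union_right
    (by
      rintro _ (⟨l, rfl⟩ | hx)
      · exact hleft l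
      · exact hLL _ hx)
    (by
      rintro _ (⟨l, rfl⟩ | hx) y hy
      · exact hright l y hy
      · exact hLL _ hy _ hx)
    htr
  have hρL : wp [none] = (ρ, τ) := by simp [wp, wordProd]
  have h1 := hVg _ (Or.inl ⟨[none], rfl⟩)
  have h2 := hVL _ (hwpL [none] (Or.inl (by simp)))
  rw [hρL] at h1 h2
  refine ⟨V, hV, fun g => ?_, ?_, h2.1, fun hKK => ?_⟩
  · have := hVg _ (Or.inl ⟨[some g], rfl⟩)
    simpa [wp, wordProd] using this
  · have h3 := congrArg conjTranspose h2.2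
    rw [conjTranspose_mul, conjTranspose_mul, conjTranspose_conjTranspose, hτ.eq] at h3
    rw [h1, Matrix.mul_assoc, h3]
  · have := (hVL _ (hwpL [] (Or.inr hKK))).1
    simpa [wp] using this

end Words

/-- The commutation clause lets the square root of a Choi matrix inherit its symmetry. -/
theorem exists_hermitian_sqrt {A : Type*} [Fintype A] [DecidableEq A] {J : Matrix A A ℂ}
    (hJ : J.PosSemidef) : ∃ Q : Matrix A A ℂ, Qᴴ = Q ∧ Q * Q = J ∧
      ∀ M, Commute J M → Commute Q M := by
  have hc : ∀ f : ℝ → ℝ, ContinuousOn f (spectrum ℝ J) := fun f =>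
    (finite_real_spectrum (A := J)).continuousOn f
  refine ⟨cfc Real.sqrt J, cfc_predicate Real.sqrt J, ?_, fun M hM => hM.cfc_real _⟩
  rw [← cfc_mul Real.sqrt Real.sqrt J (hc _) (hc _)]
  conv_rhs => rw [← cfc_id' ℝ J hJ.1]
  refine cfc_congr fun x hx => Real.mul_self_sqrt ?_
  rw [hJ.1.spectrum_real_eq_range_eigenvalues] at hx
  obtain ⟨i, rfl⟩ := hx
  exact hJ.eigenvalues_nonneg i

/-! ### Partial traces, reordering of factors and pure marginals -/

section PartialTrace

variable {A B C E F S : Type*}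

theorem partialTrace_apply [Fintype E] (X : Matrix (A × E) (A × E) ℂ) (a a' : A) :
    partialTrace X a a' = ∑ e, X (a, e) (a', e) := rfl

theorem partialTrace_kronecker [Fintype E] (X : Matrix A A ℂ) (Y : Matrix E E ℂ) :
    partialTrace (X ⊗ₖ Y) = Y.trace • X := by
  ext a a'
  simp [partialTrace_apply, Matrix.trace, Finset.mul_sum, mul_comm]

theorem trace_partialTrace [Fintype A] [Fintype E] (X : Matrix (A × E) (A × E) ℂ) :
    (partialTrace X).trace = X.trace := by
  simp [Matrix.trace, partialTrace_apply, Fintype.sum_prod_type]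

theorem partialTrace_mul_kronecker_one [Fintype A] [Fintype E] [DecidableEq E]
    (X : Matrix (A × E) (A × E) ℂ) (M : Matrix A A ℂ) :
    partialTrace (X * (M ⊗ₖ (1 : Matrix E E ℂ))) = partialTrace X * M := by
  ext a a'
  simp only [partialTrace_apply, Matrix.mul_apply, Fintype.sum_prod_type, kroneckerMap_apply,
    Matrix.one_apply, mul_ite, mul_one, mul_zero, Finset.sum_ite_eq', Finset.mem_univ, if_true,
    Finset.sum_mul]
  exact Finset.sum_comm

/-- The factor `N` on the discarded system drops out by cyclicity of the trace over `E`. -/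
theorem partialTrace_conj [Fintype A] [Fintype E] [DecidableEq A] [DecidableEq E]
    (X : Matrix (A × E) (A × E) ℂ) (M : Matrix A A ℂ) {N : Matrix E E ℂ} (hN : Nᴴ * N = 1) :
    partialTrace ((M ⊗ₖ N) * X * (M ⊗ₖ N)ᴴ) = M * partialTrace X * Mᴴ := by
  have h1 : ∀ Y : Matrix (A × E) (A × E) ℂ,
      partialTrace ((M ⊗ₖ (1 : Matrix E E ℂ)) * Y) = M * partialTrace Y := by
    intro Y
    ext a a'
    simp only [partialTrace_apply, Matrix.mul_apply, Fintype.sum_prod_type, kroneckerMap_apply,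
      Matrix.one_apply, mul_ite, mul_one, mul_zero, ite_mul, zero_mul, Finset.sum_ite_eq,
      Finset.mem_univ, if_true, Finset.mul_sum]
    exact Finset.sum_comm
  have h2 : ∀ Y : Matrix (A × E) (A × E) ℂ,
      partialTrace (((1 : Matrix A A ℂ) ⊗ₖ N) * Y * ((1 : Matrix A A ℂ) ⊗ₖ Nᴴ)) =
        partialTrace Y := by
    intro Y
    ext a a'
    have h3 : ∀ p q, ∑ e, Nᴴ p e * N e q = (1 : Matrix E E ℂ) p q := fun p q => by
      rw [← hN, Matrix.mul_apply]
    simp only [partialTrace_apply, Matrix.mul_apply, Fintype.sum_prod_type, kroneckerMap_apply,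
      Matrix.one_apply, mul_ite, one_mul, mul_zero, ite_mul, zero_mul, Finset.sum_mul,
      Finset.sum_ite_irrel, Finset.sum_const_zero, Finset.sum_ite_eq, Finset.sum_ite_eq',
      Finset.mem_univ, if_true]
    calc ∑ e, ∑ q, ∑ p, N e p * Y (a, p) (a', q) * Nᴴ q e
        = ∑ q, ∑ p, (∑ e, Nᴴ q e * N e p) * Y (a, p) (a', q) := by
          rw [Finset.sum_comm]
          refine Finset.sum_congr rfl fun q _ => ?_
          rw [Finset.sum_comm]
          refine Finset.sum_congr rfl fun p _ => ?_
          rw [Finset.sum_mul]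
          exact Finset.sum_congr rfl fun e _ => by ring
      _ = ∑ e, Y (a, e) (a', e) := by
          simp only [h3]
          simp [Matrix.one_apply]
  have h3 : (M ⊗ₖ N) = (M ⊗ₖ (1 : Matrix E E ℂ)) * ((1 : Matrix A A ℂ) ⊗ₖ N) := by
    rw [← mul_kronecker_mul, Matrix.mul_one, Matrix.one_mul]
  have h4 : (M ⊗ₖ N)ᴴ = ((1 : Matrix A A ℂ) ⊗ₖ Nᴴ) * (Mᴴ ⊗ₖ (1 : Matrix E E ℂ)) := by
    rw [← mul_kronecker_mul, Matrix.mul_one, Matrix.one_mul, conjTranspose_kronecker]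
  rw [h4, h3, ← Matrix.mul_assoc, partialTrace_mul_kronecker_one, Matrix.mul_assoc _ _ X,
    Matrix.mul_assoc, h1, h2]

theorem kronecker_left_injective [Fintype C] {σ : Matrix C C ℂ} (hσ : σ.trace = 1)
    {X Y : Matrix A A ℂ} (h : X ⊗ₖ σ = Y ⊗ₖ σ) : X = Y := by
  have := congrArg partialTrace h
  simpa [partialTrace_kronecker, hσ] using this

/-- The bijection behind `reorder`. -/
def reorderEquiv (S C E : Type*) : (S × E) × C ≃ (S × C) × E where
  toFun p := ((p.1.1, p.2), p.1.2)
  invFun p := ((p.1.1, p.2), p.1.2)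

theorem reorder_eq_submatrix (X : Matrix ((S × C) × E) ((S × C) × E) ℂ) :
    reorder X = X.submatrix (reorderEquiv S C E) (reorderEquiv S C E) := rfl

theorem reorder_mul [Fintype S] [Fintype C] [Fintype E]
    (X Y : Matrix ((S × C) × E) ((S × C) × E) ℂ) :
    reorder (X * Y) = reorder X * reorder Y := by
  simp only [reorder_eq_submatrix, Matrix.submatrix_mul_equiv]

theorem reorder_conjTranspose (X : Matrix ((S × C) × E) ((S × C) × E) ℂ) :
    reorder Xᴴ = (reorder X)ᴴ := rfl

theorem reorder_kronecker (X : Matrix S S ℂ) (Y : Matrix C C ℂ) (Z : Matrix E E ℂ) :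
    reorder ((X ⊗ₖ Y) ⊗ₖ Z) = (X ⊗ₖ Z) ⊗ₖ Y := by
  ext p q
  simp [reorder]
  ring

theorem partialTrace_of_reorder_eq [Fintype E] {Y : Matrix ((S × C) × E) ((S × C) × E) ℂ}
    {τ : Matrix (S × E) (S × E) ℂ} {σ : Matrix C C ℂ} (h : reorder Y = τ ⊗ₖ σ) :
    partialTrace Y = partialTrace τ ⊗ₖ σ := by
  ext p q
  have : ∀ e, Y (p, e) (q, e) = τ (p.1, e) (q.1, e) * σ p.2 q.2 := fun e =>
    congrFun (congrFun h ((p.1, e), p.2)) ((q.1, e), q.2)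
  simp [partialTrace_apply, this, Finset.sum_mul]

theorem IsPureState.isDensityMatrix [Fintype C] {σ : Matrix C C ℂ} (hσ : IsPureState σ) :
    IsDensityMatrix σ := by
  obtain ⟨ψ, hψ, rfl⟩ := hσ
  refine ⟨posSemidef_vecMulVec_self_star ψ, ?_⟩
  rw [trace_vecMulVec, dotProduct_comm, hψ]

/-- A state with a pure marginal is a product. -/
theorem exists_reorder_eq_of_isPureState [Fintype S] [Fintype C] [Fintype E] [DecidableEq S]
    [DecidableEq C] [DecidableEq E] {Y : Matrix ((S × C) × E) ((S × C) × E) ℂ}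
    (hY : Y.PosSemidef) {ρ' : Matrix S S ℂ} {σ : Matrix C C ℂ} (hσ : IsPureState σ)
    (h : partialTrace Y = ρ' ⊗ₖ σ) : ∃ τ, reorder Y = τ ⊗ₖ σ := by
  have hσd := hσ.isDensityMatrix
  obtain ⟨ψ, hψ, hψσ⟩ := hσ
  have hσσ : σ * σ = σ := by
    rw [hψσ, vecMulVec_mul_vecMulVec, hψ, one_smul]
  let N : Matrix ((S × C) × E) ((S × C) × E) ℂ :=
    ((1 : Matrix S S ℂ) ⊗ₖ (1 - σ)) ⊗ₖ (1 : Matrix E E ℂ)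
  have hN : Nᴴ = N := by
    simp only [N, conjTranspose_kronecker, conjTranspose_sub, conjTranspose_one, hσd.1.1.eq]
  have hNN : N * N = N := by
    have : (1 - σ) * (1 - σ) = 1 - σ := by
      simp [Matrix.mul_sub, Matrix.sub_mul, hσσ]
    simp only [N, ← mul_kronecker_mul, this, Matrix.one_mul]
  -- `N` projects `C` onto the complement of the pure state. `Y` has no weight there, and positivity
  -- turns this into `Y * N = 0`.
  have htr : (Nᴴ * Y * N).trace = 0 := by
    rw [hN, trace_mul_comm, ← Matrix.mul_assoc, hNN, trace_mul_comm, ← trace_partialTrace,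
      partialTrace_mul_kronecker_one, h, ← mul_kronecker_mul]
    simp [Matrix.mul_sub, hσσ]
  obtain ⟨B, hB, hBY, -⟩ := exists_hermitian_sqrt hY
  have hYN : Y * N = 0 := by
    have : B * N = 0 := by
      refine trace_conjTranspose_mul_self_eq_zero_iff.1 ?_
      rw [conjTranspose_mul, Matrix.mul_assoc, ← Matrix.mul_assoc Bᴴ, hB, hBY, ← Matrix.mul_assoc]
      exact htr
    rw [← hBY, Matrix.mul_assoc, this, Matrix.mul_zero]
  have hNY : N * Y = 0 := by
    have := congrArg conjTranspose hYN
    rwa [conjTranspose_mul, hN, hY.1.eq, conjTranspose_zero] at this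
  let Q : Matrix ((S × C) × E) ((S × C) × E) ℂ :=
    ((1 : Matrix S S ℂ) ⊗ₖ σ) ⊗ₖ (1 : Matrix E E ℂ)
  have hNQ : N = 1 - Q := by
    have : (1 : Matrix S S ℂ) ⊗ₖ (1 - σ) = 1 - (1 : Matrix S S ℂ) ⊗ₖ σ := by
      rw [eq_sub_iff_add_eq, ← kronecker_add, sub_add_cancel, one_kronecker_one]
    simp only [N, Q, this]
    rw [eq_sub_iff_add_eq, ← add_kronecker, sub_add_cancel, one_kronecker_one]
  have hYQ : Q * Y * Q = Y := by
    rw [hNQ, Matrix.sub_mul, sub_eq_zero, Matrix.one_mul] at hNY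
    rw [hNQ, Matrix.mul_sub, sub_eq_zero, Matrix.mul_one] at hYN
    rw [← hNY, ← hYN]
  -- `τ` is the partial matrix element of `Y` in the vector `ψ` of the catalyst.
  refine ⟨Matrix.of fun x y => ∑ c, ∑ d, star (ψ c) * Y ((x.1, c), x.2) ((y.1, d), y.2) * ψ d, ?_⟩
  conv_lhs => rw [← hYQ, reorder_mul, reorder_mul]
  have hQ : reorder Q = (1 : Matrix (S × E) (S × E) ℂ) ⊗ₖ σ := by
    rw [reorder_kronecker, one_kronecker_one]
  rw [hQ]
  ext ⟨x, c⟩ ⟨y, d⟩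
  simp only [Matrix.mul_apply, Fintype.sum_prod_type (α₁ := S × E), kroneckerMap_apply,
    Matrix.one_apply, ite_mul, one_mul, zero_mul, mul_ite, mul_zero, Finset.sum_ite_irrel,
    Finset.sum_const_zero, Finset.sum_ite_eq, Finset.sum_ite_eq', Finset.mem_univ, if_true,
    Matrix.of_apply, hψσ, vecMulVec_apply, Finset.sum_mul, Pi.star_apply]
  rw [Finset.sum_comm]
  refine Finset.sum_congr rfl fun c' _ => Finset.sum_congr rfl fun d' _ => ?_
  simp only [reorder, Matrix.of_apply]
  ring

end PartialTrace

/-! ### Complete positivity and covariance of dilated maps -/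

section Channels

variable {A B E : Type*} [Fintype A] [Fintype B] [Fintype E]

theorem ampliation_posSemidef_of_kraus {ι : Type*} [Fintype ι]
    {T : Matrix A A ℂ →ₗ[ℂ] Matrix B B ℂ} (K : ι → Matrix B A ℂ)
    (hT : ∀ X, T X = ∑ i, K i * X * (K i)ᴴ) (k : ℕ) {X : Matrix (Fin k × A) (Fin k × A) ℂ}
    (hX : X.PosSemidef) : (ampliation T k X).PosSemidef := by
  have : ampliation T k X = ∑ i, ((1 : Matrix (Fin k) (Fin k) ℂ) ⊗ₖ K i) * X *
      ((1 : Matrix (Fin k) (Fin k) ℂ) ⊗ₖ K i)ᴴ := by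
    ext ⟨p, b⟩ ⟨q, b'⟩
    simp only [ampliation, Matrix.of_apply, hT, Matrix.sum_apply]
    refine Finset.sum_congr rfl fun i _ => ?_
    simp only [Matrix.mul_apply, Fintype.sum_prod_type, kroneckerMap_apply, conjTranspose_kronecker,
      conjTranspose_one, Matrix.one_apply, ite_mul, one_mul, zero_mul, mul_ite, mul_zero,
      Finset.sum_ite_irrel, Finset.sum_const_zero, Finset.sum_ite_eq, Finset.sum_ite_eq',
      Finset.mem_univ, if_true, Matrix.of_apply]
  rw [this]
  exact posSemidef_sum _ fun i _ => hX.mul_mul_conjTranspose_same _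

theorem dilatedMap_isQuantumChannel [DecidableEq A] [DecidableEq E]
    (U : unitaryGroup (A × E) ℂ) {γ : Matrix E E ℂ} (hγ : IsDensityMatrix γ) :
    IsQuantumChannel (dilatedMap U γ) := by
  constructor
  · intro k X hX
    obtain ⟨Q, hQh, hQ, -⟩ := exists_hermitian_sqrt hγ.1
    let M : Matrix (A × E) (A × E) ℂ := U * ((1 : Matrix A A ℂ) ⊗ₖ Q)
    -- The Kraus operators are the `E`-blocks of `U (1 ⊗ √γ)`.
    refine ampliation_posSemidef_of_kraus (ι := E × E)
      (fun i => Matrix.of fun a a' => M (a, i.1) (a', i.2)) (fun X => ?_) k hX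
    have : (U : Matrix (A × E) (A × E) ℂ) * (X ⊗ₖ γ) * (U : Matrix (A × E) (A × E) ℂ)ᴴ =
        M * (X ⊗ₖ (1 : Matrix E E ℂ)) * Mᴴ := by
      have h1 : X ⊗ₖ γ = ((1 : Matrix A A ℂ) ⊗ₖ Q) * (X ⊗ₖ (1 : Matrix E E ℂ)) *
          ((1 : Matrix A A ℂ) ⊗ₖ Q)ᴴ := by
        rw [conjTranspose_kronecker, ← mul_kronecker_mul, ← mul_kronecker_mul,
          hQh, Matrix.mul_one, hQ, conjTranspose_one, Matrix.mul_one,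
          Matrix.one_mul]
      rw [h1, conjTranspose_mul]
      simp only [M, Matrix.mul_assoc]
    change partialTrace _ = _
    rw [this]
    ext a a'
    simp only [partialTrace_apply, Matrix.sum_apply, Matrix.mul_apply, Fintype.sum_prod_type,
      kroneckerMap_apply, Matrix.one_apply, mul_ite, mul_one, mul_zero, Finset.sum_ite_eq',
      Finset.mem_univ, if_true, Matrix.of_apply, conjTranspose_apply, Finset.sum_mul]
    refine Finset.sum_congr rfl fun e _ => ?_
    rw [Finset.sum_comm]
  · intro X
    change (partialTrace _).trace = _
    have hU : (U : Matrix (A × E) (A × E) ℂ)ᴴ * (U : Matrix (A × E) (A × E) ℂ) = 1 :=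
      mem_unitaryGroup_iff'.1 U.2
    rw [trace_partialTrace, trace_mul_comm, ← Matrix.mul_assoc, hU, Matrix.one_mul,
      trace_kronecker, hγ.2, mul_one]

theorem dilatedMap_isCovariantChannel {G : Type*} [Group G] [DecidableEq A] [DecidableEq E]
    {WA WA' : G →* unitaryGroup A ℂ} {WE WE' : G →* unitaryGroup E ℂ}
    {U : unitaryGroup (A × E) ℂ} {γ : Matrix E E ℂ} (hγ : IsDensityMatrix γ)
    (hsymm : IsSymmetricState WE γ) (hU : Intertwines U (tensorRep WA WE) (tensorRep WA' WE')) :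
    IsCovariantChannel WA WA' (dilatedMap U γ) := by
  refine ⟨dilatedMap_isQuantumChannel U hγ, fun g X => ?_⟩
  have hUg : (U : Matrix (A × E) (A × E) ℂ) * ((WA g : Matrix A A ℂ) ⊗ₖ (WE g : Matrix E E ℂ)) =
      ((WA' g : Matrix A A ℂ) ⊗ₖ (WE' g : Matrix E E ℂ)) * (U : Matrix (A × E) (A × E) ℂ) := hU g
  have hUg' := congrArg conjTranspose hUg
  rw [conjTranspose_mul, conjTranspose_mul] at hUg'
  change partialTrace _ = _ * partialTrace _ * _
  rw [← partialTrace_conj _ _ (mem_unitaryGroup_iff'.1 (WE' g).2)]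
  congr 1
  have h1 : ((WA g : Matrix A A ℂ) * X * (WA g : Matrix A A ℂ)ᴴ) ⊗ₖ γ =
      ((WA g : Matrix A A ℂ) ⊗ₖ (WE g : Matrix E E ℂ)) * (X ⊗ₖ γ) *
        ((WA g : Matrix A A ℂ) ⊗ₖ (WE g : Matrix E E ℂ))ᴴ := by
    rw [conjTranspose_kronecker, ← mul_kronecker_mul, ← mul_kronecker_mul, hsymm g]
  rw [h1]
  calc _ = ((U : Matrix (A × E) (A × E) ℂ) * ((WA g : Matrix A A ℂ) ⊗ₖ (WE g : Matrix E E ℂ))) *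
        (X ⊗ₖ γ) * (((WA g : Matrix A A ℂ) ⊗ₖ (WE g : Matrix E E ℂ))ᴴ *
          (U : Matrix (A × E) (A × E) ℂ)ᴴ) := by simp only [Matrix.mul_assoc]
    _ = _ := by
        rw [hUg, hUg']
        simp only [Matrix.mul_assoc]

end Channels

theorem tensorRep_continuous {G : Type*} [Group G] [TopologicalSpace G] {S C : Type*} [Fintype S]
    [DecidableEq S] [Fintype C] [DecidableEq C] {W : G →* unitaryGroup S ℂ} {W' : G →* unitaryGroup C ℂ}
    (hW : Continuous W) (hW' : Continuous W') : Continuous (tensorRep W W') := by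
  refine Continuous.subtype_mk ?_ _
  refine continuous_matrix fun p q => ?_
  have h1 := (continuous_subtype_val.comp hW).matrix_elem p.1 q.1
  have h2 := (continuous_subtype_val.comp hW').matrix_elem p.2 q.2
  exact h1.mul h2

/-! ### Removing the catalyst from unitary dynamics -/

section Catalysis

variable {G : Type*} [Group G] [TopologicalSpace G] [ConnectedSpace G]
  {S C E : Type*} [Fintype S] [DecidableEq S] [Fintype C] [DecidableEq C]
  [Fintype E] [DecidableEq E]

theorem exists_unitary_of_catalysis {WS WS' : G →* unitaryGroup S ℂ} {WC : G →* unitaryGroup C ℂ}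
    (hWS : Continuous WS) (hWS' : Continuous WS') (hWC : Continuous WC) {ρ ρ' : Matrix S S ℂ}
    {σ : Matrix C C ℂ} (hρ : ρ.IsHermitian) (hρ' : ρ'.IsHermitian) (hσ : IsDensityMatrix σ)
    {U : unitaryGroup (S × C) ℂ}
    (hU : (U : Matrix (S × C) (S × C) ℂ) * (ρ ⊗ₖ σ) * (U : Matrix (S × C) (S × C) ℂ)ᴴ = ρ' ⊗ₖ σ)
    (hUW : Intertwines U (tensorRep WS WC) (tensorRep WS' WC)) :
    ∃ V : unitaryGroup S ℂ, (V : Matrix S S ℂ) * ρ * (V : Matrix S S ℂ)ᴴ = ρ' ∧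
      Intertwines V WS WS' := by
  obtain ⟨V, -, hV, hVρ, -, h1⟩ := exists_partialIsometry_of_catalysis hWS hWS' hWC hρ hρ' hσ
    (mem_unitaryGroup_iff'.1 U.2) hUW hU
  exact ⟨⟨V, mem_unitaryGroup_iff'.2 (h1 (mem_unitaryGroup_iff.1 U.2))⟩, hVρ, hV⟩

/-- A catalyst that is returned uncorrelated with system and environment can be dispensed with. -/
theorem exists_unitary_of_catalysis_environment {WS WS' : G →* unitaryGroup S ℂ}
    {WC : G →* unitaryGroup C ℂ} {WE WE' : G →* unitaryGroup E ℂ} (hWS : Continuous WS)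
    (hWS' : Continuous WS') (hWC : Continuous WC) (hWE : Continuous WE) (hWE' : Continuous WE')
    {ρ : Matrix S S ℂ} {σ : Matrix C C ℂ} {γ : Matrix E E ℂ} {τ : Matrix (S × E) (S × E) ℂ}
    (hρ : ρ.IsHermitian) (hσ : IsDensityMatrix σ) (hγ : γ.IsHermitian)
    {U : unitaryGroup ((S × C) × E) ℂ}
    (hUW : Intertwines U (tensorRep (tensorRep WS WC) WE) (tensorRep (tensorRep WS' WC) WE'))
    (hU : reorder ((U : Matrix ((S × C) × E) ((S × C) × E) ℂ) * ((ρ ⊗ₖ σ) ⊗ₖ γ) *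
      (U : Matrix ((S × C) × E) ((S × C) × E) ℂ)ᴴ) = τ ⊗ₖ σ) :
    ∃ V : unitaryGroup (S × E) ℂ,
      (V : Matrix (S × E) (S × E) ℂ) * (ρ ⊗ₖ γ) * (V : Matrix (S × E) (S × E) ℂ)ᴴ = τ ∧
      Intertwines V (tensorRep WS WE) (tensorRep WS' WE') ∧
      dilatedMap U γ (ρ ⊗ₖ σ) = (dilatedMap V γ ρ) ⊗ₖ σ := by
  have hργ : (ρ ⊗ₖ γ).IsHermitian := by
    rw [Matrix.IsHermitian, conjTranspose_kronecker, hρ.eq, hγ.eq]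
  have hU' := hU
  rw [reorder_mul, reorder_mul, reorder_kronecker, reorder_conjTranspose] at hU'
  have hτ : τ.IsHermitian := by
    refine kronecker_left_injective hσ.2 ?_
    have h1 : (τ ⊗ₖ σ)ᴴ = τ ⊗ₖ σ := by
      rw [← hU']
      simp only [conjTranspose_mul, conjTranspose_conjTranspose, conjTranspose_kronecker, hρ.eq,
        hγ.eq, hσ.1.1.eq, Matrix.mul_assoc]
    rwa [conjTranspose_kronecker, hσ.1.1.eq] at h1
  let U' : unitaryGroup ((S × E) × C) ℂ := ⟨reorder U, mem_unitaryGroup_iff.2 (by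
    rw [star_eq_conjTranspose, ← reorder_conjTranspose, ← reorder_mul,
      ← star_eq_conjTranspose, mem_unitaryGroup_iff.1 U.2, reorder_eq_submatrix,
      submatrix_one_equiv])⟩
  -- The environment is counted as part of the system, so `ρ ⊗ γ` is the state transformed with the
  -- help of `σ`.
  obtain ⟨V, hV, hVW⟩ := exists_unitary_of_catalysis (U := U') (tensorRep_continuous hWS hWE)
    (tensorRep_continuous hWS' hWE') hWC hργ hτ hσ hU' (fun g => by
      have := congrArg reorder (hUW g)
      rw [reorder_mul, reorder_mul] at this
      erw [reorder_kronecker, reorder_kronecker] at this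
      exact this)
  refine ⟨V, hV, hVW, ?_⟩
  change partialTrace _ = partialTrace _ ⊗ₖ σ
  rw [hV, partialTrace_of_reorder_eq hU]

end Catalysis

/-! ### Energy conservation as covariance under time evolution -/

section Athermality

variable {A B E : Type*} [Fintype A] [DecidableEq A] [Fintype B] [DecidableEq B]
  [Fintype E] [DecidableEq E]

/-- The unitary time evolution `t ↦ exp (i t H)`. -/
def timeEvolution (H : Matrix A A ℂ) (hH : H.IsHermitian) :
    Multiplicative ℝ →* unitaryGroup A ℂ where
  toFun t := ⟨NormedSpace.exp (t.toAdd • (Complex.I • H)), mem_unitaryGroup_iff.2 (by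
    have h1 : (t.toAdd • (Complex.I • H))ᴴ = -(t.toAdd • (Complex.I • H)) := by
      simp [conjTranspose_smul, hH.eq]
    rw [star_eq_conjTranspose, ← exp_conjTranspose, h1, Matrix.exp_neg]
    exact Matrix.mul_nonsing_inv _ ((isUnit_iff_isUnit_det _).1 (Matrix.isUnit_exp _)))⟩
  map_one' := by
    apply Subtype.ext
    simp
  map_mul' s t := by
    apply Subtype.ext
    change NormedSpace.exp ((s * t).toAdd • (Complex.I • H)) = NormedSpace.exp _ * NormedSpace.exp _
    rw [toAdd_mul, add_smul]
    exact Matrix.exp_add_of_commute _ _ (((Commute.refl _).smul_left _).smul_right _)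

theorem timeEvolution_continuous {H : Matrix A A ℂ} (hH : H.IsHermitian) :
    Continuous (timeEvolution H hH) := by
  let _ : NormedRing (Matrix A A ℂ) := Matrix.linftyOpNormedRing
  let _ : NormedAlgebra ℂ (Matrix A A ℂ) := Matrix.linftyOpNormedAlgebra
  let _ : NormedAlgebra ℚ (Matrix A A ℂ) := NormedAlgebra.restrictScalars ℚ ℂ _
  refine Continuous.subtype_mk ?_ _
  refine NormedSpace.exp_continuous.comp ?_
  exact (continuous_toAdd (X := ℝ)).smul continuous_const

theorem totalHamiltonian_isHermitian {A B : Type*} [DecidableEq A] [DecidableEq B] {H : Matrix A A ℂ} {H' : Matrix B B ℂ} (hH : H.IsHermitian)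
    (hH' : H'.IsHermitian) : (totalHamiltonian H H').IsHermitian := by
  rw [Matrix.IsHermitian, totalHamiltonian, conjTranspose_add, conjTranspose_kronecker,
    conjTranspose_kronecker, conjTranspose_one, conjTranspose_one, hH.eq, hH'.eq]

/-- Tensoring with the identity is a continuous ring homomorphism, and these commute with the
exponential series. -/
theorem exp_kronecker_one (X : Matrix A A ℂ) :
    NormedSpace.exp (X ⊗ₖ (1 : Matrix B B ℂ)) = NormedSpace.exp X ⊗ₖ (1 : Matrix B B ℂ) := by
  let _ : NormedRing (Matrix A A ℂ) := Matrix.linftyOpNormedRing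
  let _ : NormedAlgebra ℂ (Matrix A A ℂ) := Matrix.linftyOpNormedAlgebra
  let _ : NormedAlgebra ℚ (Matrix A A ℂ) := NormedAlgebra.restrictScalars ℚ ℂ _
  let _ : NormedRing (Matrix (A × B) (A × B) ℂ) := Matrix.linftyOpNormedRing
  let _ : NormedAlgebra ℂ (Matrix (A × B) (A × B) ℂ) := Matrix.linftyOpNormedAlgebra
  let _ : NormedAlgebra ℚ (Matrix (A × B) (A × B) ℂ) := NormedAlgebra.restrictScalars ℚ ℂ _
  let f : Matrix A A ℂ →+* Matrix (A × B) (A × B) ℂ :=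
    { toFun := fun Y => Y ⊗ₖ (1 : Matrix B B ℂ)
      map_one' := one_kronecker_one
      map_zero' := zero_kronecker _
      map_mul' := fun Y Z => by rw [← mul_kronecker_mul, Matrix.one_mul]
      map_add' := fun Y Z => add_kronecker _ _ _ }
  have hf : Continuous f := by
    refine continuous_matrix fun p q => ?_
    exact (continuous_id.matrix_elem p.1 q.1).mul continuous_const
  exact (NormedSpace.map_exp f hf X).symm

theorem exp_one_kronecker (X : Matrix B B ℂ) :
    NormedSpace.exp ((1 : Matrix A A ℂ) ⊗ₖ X) = (1 : Matrix A A ℂ) ⊗ₖ NormedSpace.exp X := by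
  let _ : NormedRing (Matrix B B ℂ) := Matrix.linftyOpNormedRing
  let _ : NormedAlgebra ℂ (Matrix B B ℂ) := Matrix.linftyOpNormedAlgebra
  let _ : NormedAlgebra ℚ (Matrix B B ℂ) := NormedAlgebra.restrictScalars ℚ ℂ _
  let _ : NormedRing (Matrix (A × B) (A × B) ℂ) := Matrix.linftyOpNormedRing
  let _ : NormedAlgebra ℂ (Matrix (A × B) (A × B) ℂ) := Matrix.linftyOpNormedAlgebra
  let _ : NormedAlgebra ℚ (Matrix (A × B) (A × B) ℂ) := NormedAlgebra.restrictScalars ℚ ℂ _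
  let f : Matrix B B ℂ →+* Matrix (A × B) (A × B) ℂ :=
    { toFun := fun Y => (1 : Matrix A A ℂ) ⊗ₖ Y
      map_one' := one_kronecker_one
      map_zero' := kronecker_zero _
      map_mul' := fun Y Z => by rw [← mul_kronecker_mul, Matrix.one_mul]
      map_add' := fun Y Z => kronecker_add _ _ _ }
  have hf : Continuous f := by
    refine continuous_matrix fun p q => ?_
    exact continuous_const.mul (continuous_id.matrix_elem p.2 q.2)
  exact (NormedSpace.map_exp f hf X).symm

theorem tensorRep_timeEvolution {H : Matrix A A ℂ} {H' : Matrix B B ℂ} (hH : H.IsHermitian)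
    (hH' : H'.IsHermitian) : tensorRep (timeEvolution H hH) (timeEvolution H' hH') =
      timeEvolution (totalHamiltonian H H') (totalHamiltonian_isHermitian hH hH') := by
  refine MonoidHom.ext fun t => Subtype.ext ?_
  change NormedSpace.exp _ ⊗ₖ NormedSpace.exp _ = NormedSpace.exp _
  have h1 : t.toAdd • (Complex.I • totalHamiltonian H H') =
      (t.toAdd • (Complex.I • H)) ⊗ₖ (1 : Matrix B B ℂ) +
        (1 : Matrix A A ℂ) ⊗ₖ (t.toAdd • (Complex.I • H')) := by
    simp only [totalHamiltonian, smul_add, smul_kronecker, kronecker_smul]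
  have hcomm : Commute ((t.toAdd • (Complex.I • H)) ⊗ₖ (1 : Matrix B B ℂ))
      ((1 : Matrix A A ℂ) ⊗ₖ (t.toAdd • (Complex.I • H'))) := by
    change _ * _ = _ * _
    rw [← mul_kronecker_mul, ← mul_kronecker_mul, Matrix.mul_one, Matrix.mul_one, Matrix.one_mul,
      Matrix.one_mul]
  rw [h1, Matrix.exp_add_of_commute _ _ hcomm, exp_kronecker_one, exp_one_kronecker,
    ← mul_kronecker_mul, Matrix.mul_one, Matrix.one_mul]

/-- Differentiating the intertwining relation at time zero recovers the Hamiltonian. Conversely,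
whatever commutes with `H` commutes with its exponentials. -/
theorem intertwines_timeEvolution_iff {H : Matrix A A ℂ} (hH : H.IsHermitian)
    (U : unitaryGroup A ℂ) : Intertwines U (timeEvolution H hH) (timeEvolution H hH) ↔
      Commute (U : Matrix A A ℂ) H := by
  let _ : NormedRing (Matrix A A ℂ) := Matrix.linftyOpNormedRing
  let _ : NormedAlgebra ℂ (Matrix A A ℂ) := Matrix.linftyOpNormedAlgebra
  let _ : NormedAlgebra ℚ (Matrix A A ℂ) := NormedAlgebra.restrictScalars ℚ ℂ _
  let _ : NormedAlgebra ℝ (Matrix A A ℂ) := NormedAlgebra.restrictScalars ℝ ℂ _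
  constructor
  · intro h
    have hd := hasDerivAt_exp_smul_const (𝕂 := ℝ) (Complex.I • H) 0
    rw [zero_smul, NormedSpace.exp_zero, one_mul] at hd
    have h1 := hd.const_mul (U : Matrix A A ℂ)
    have h2 := hd.mul_const (U : Matrix A A ℂ)
    have h4 := h1.unique (h2.congr_of_eventuallyEq
      (Filter.Eventually.of_forall fun t => h (Multiplicative.ofAdd t)))
    rw [Matrix.mul_smul, Matrix.smul_mul] at h4
    exact smul_right_injective _ Complex.I_ne_zero h4
  · intro h t
    exact ((h.smul_right _).smul_right _).exp_right

theorem exp_posSemidef {H : Matrix A A ℂ} (hH : H.IsHermitian) :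
    (NormedSpace.exp H).PosSemidef := by
  have h1 : ((2⁻¹ : ℝ) • H).IsHermitian := by
    rw [Matrix.IsHermitian, conjTranspose_smul, hH.eq, star_trivial]
  have h2 : NormedSpace.exp H =
      (NormedSpace.exp ((2⁻¹ : ℝ) • H))ᴴ * NormedSpace.exp ((2⁻¹ : ℝ) • H) := by
    rw [h1.exp.eq, ← Matrix.exp_add_of_commute _ _ (Commute.refl _), ← add_smul]
    norm_num
  rw [h2]
  exact posSemidef_conjTranspose_mul_self _

theorem gibbsState_posSemidef (β : ℝ) {H : Matrix A A ℂ} (hH : H.IsHermitian) :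
    (gibbsState β H).PosSemidef := by
  have h1 : (-(β : ℂ) • H).IsHermitian := by
    rw [Matrix.IsHermitian, conjTranspose_smul, hH.eq]
    simp
  have h2 := exp_posSemidef h1
  refine h2.smul ?_
  exact inv_nonneg.2 h2.trace_nonneg

theorem gibbsState_submatrix (β : ℝ) (H : Matrix A A ℂ) (e : B ≃ A) :
    gibbsState β (H.submatrix e e) = (gibbsState β H).submatrix e e := by
  let _ : NormedRing (Matrix A A ℂ) := Matrix.linftyOpNormedRing
  let _ : NormedAlgebra ℂ (Matrix A A ℂ) := Matrix.linftyOpNormedAlgebra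
  let _ : NormedAlgebra ℚ (Matrix A A ℂ) := NormedAlgebra.restrictScalars ℚ ℂ _
  let _ : NormedRing (Matrix B B ℂ) := Matrix.linftyOpNormedRing
  let _ : NormedAlgebra ℂ (Matrix B B ℂ) := Matrix.linftyOpNormedAlgebra
  let _ : NormedAlgebra ℚ (Matrix B B ℂ) := NormedAlgebra.restrictScalars ℚ ℂ _
  have hf : Continuous (reindexAlgEquiv ℂ ℂ e.symm) := continuous_id.matrix_submatrix _ _
  have h1 : NormedSpace.exp (-(β : ℂ) • H.submatrix e e) =
      (NormedSpace.exp (-(β : ℂ) • H)).submatrix e e :=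
    (NormedSpace.map_exp (reindexAlgEquiv ℂ ℂ e.symm) hf (-(β : ℂ) • H)).symm
  have h2 : ∀ M : Matrix A A ℂ, (M.submatrix e e).trace = M.trace := fun M =>
    e.sum_comp fun a => M a a
  rw [gibbsState, h1, h2]
  rfl

/-- The definition wants an environment labelled by `Fin n`, so the basis of `E` is enumerated and
everything is transported along the enumeration. -/
theorem isThermalOperation_dilatedMap [Nonempty E] {β : ℝ} {H : Matrix A A ℂ} {HE : Matrix E E ℂ}
    (hHE : HE.IsHermitian) {U : unitaryGroup (A × E) ℂ}
    (hU : Commute (U : Matrix (A × E) (A × E) ℂ) (totalHamiltonian H HE)) :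
    IsThermalOperation β H (dilatedMap U (gibbsState β HE)) := by
  let e : Fin (Fintype.card E) ≃ E := (Fintype.equivFin E).symm
  let e' : A × Fin (Fintype.card E) ≃ A × E := (Equiv.refl A).prodCongr e
  have htot : totalHamiltonian H (HE.submatrix e e) =
      (totalHamiltonian H HE).submatrix e' e' := by
    ext p q
    simp [totalHamiltonian, e', Matrix.one_apply]
  refine ⟨Fintype.card E, HE.submatrix e e,
    ⟨(U : Matrix (A × E) (A × E) ℂ).submatrix e' e', mem_unitaryGroup_iff.2 ?_⟩,
    Fintype.card_pos, hHE.submatrix _, ?_, ?_⟩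
  · rw [star_eq_conjTranspose, conjTranspose_submatrix, submatrix_mul_equiv,
      ← star_eq_conjTranspose, mem_unitaryGroup_iff.1 U.2, submatrix_one_equiv]
  · change _ * _ = _ * _
    rw [htot, submatrix_mul_equiv, submatrix_mul_equiv, hU.eq]
  · ext1 X
    rw [gibbsState_submatrix]
    have h1 : X ⊗ₖ (gibbsState β HE).submatrix e e = (X ⊗ₖ gibbsState β HE).submatrix e' e' := rfl
    change partialTrace _ = partialTrace ((U : Matrix (A × E) (A × E) ℂ).submatrix e' e' * _ *
      ((U : Matrix (A × E) (A × E) ℂ).submatrix e' e')ᴴ)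
    rw [h1, conjTranspose_submatrix, submatrix_mul_equiv, submatrix_mul_equiv]
    ext a a'
    exact (e.sum_comp fun x => ((U : Matrix (A × E) (A × E) ℂ) * (X ⊗ₖ gibbsState β HE) *
      (U : Matrix (A × E) (A × E) ℂ)ᴴ) (a, x) (a', x)).symm

theorem exists_energy_conserving_of_catalysis {S C : Type*} [Fintype S] [DecidableEq S] [Fintype C]
    [DecidableEq C] {HS : Matrix S S ℂ} {HC : Matrix C C ℂ} {HE : Matrix E E ℂ}
    (hHS : HS.IsHermitian) (hHC : HC.IsHermitian) (hHE : HE.IsHermitian)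
    {ρ : Matrix S S ℂ} {σ : Matrix C C ℂ} {γ : Matrix E E ℂ} {τ : Matrix (S × E) (S × E) ℂ}
    (hρ : ρ.IsHermitian) (hσ : IsDensityMatrix σ) (hγ : γ.IsHermitian)
    {U : unitaryGroup ((S × C) × E) ℂ}
    (hUH : Commute (U : Matrix ((S × C) × E) ((S × C) × E) ℂ)
      (totalHamiltonian (totalHamiltonian HS HC) HE))
    (hU : reorder ((U : Matrix ((S × C) × E) ((S × C) × E) ℂ) * ((ρ ⊗ₖ σ) ⊗ₖ γ) *
      (U : Matrix ((S × C) × E) ((S × C) × E) ℂ)ᴴ) = τ ⊗ₖ σ) :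
    ∃ V : unitaryGroup (S × E) ℂ,
      (V : Matrix (S × E) (S × E) ℂ) * (ρ ⊗ₖ γ) * (V : Matrix (S × E) (S × E) ℂ)ᴴ = τ ∧
      Commute (V : Matrix (S × E) (S × E) ℂ) (totalHamiltonian HS HE) ∧
      dilatedMap U γ (ρ ⊗ₖ σ) = (dilatedMap V γ ρ) ⊗ₖ σ := by
  have : ConnectedSpace (Multiplicative ℝ) := inferInstanceAs (ConnectedSpace ℝ)
  have hUW := (intertwines_timeEvolution_iff
    (totalHamiltonian_isHermitian (totalHamiltonian_isHermitian hHS hHC) hHE) U).2 hUH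
  rw [← tensorRep_timeEvolution (totalHamiltonian_isHermitian hHS hHC) hHE,
    ← tensorRep_timeEvolution hHS hHC] at hUW
  obtain ⟨V, hV, hVW, hV'⟩ := exists_unitary_of_catalysis_environment
    (timeEvolution_continuous hHS) (timeEvolution_continuous hHS) (timeEvolution_continuous hHC)
    (timeEvolution_continuous hHE) (timeEvolution_continuous hHE) hρ hσ hγ hUW hU
  rw [tensorRep_timeEvolution, intertwines_timeEvolution_iff] at hVW
  exact ⟨V, hV, hVW, hV'⟩

end Athermality

/-! ### Covariant Stinespring dilation -/

section Stinespring

variable {G A B F : Type*} [Fintype A] [DecidableEq A] [Fintype B] [DecidableEq B] [Fintype F]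

/-- The Choi matrix of a linear map. -/
def choiMatrix (T : Matrix A A ℂ →ₗ[ℂ] Matrix B B ℂ) : Matrix (B × A) (B × A) ℂ :=
  Matrix.of fun p q => T (Matrix.single p.2 q.2 1) p.1 q.1

theorem map_apply_eq_sum_choiMatrix {A B : Type*} [Fintype A] [DecidableEq A]
    (T : Matrix A A ℂ →ₗ[ℂ] Matrix B B ℂ) (X : Matrix A A ℂ)
    (b b' : B) : T X b b' = ∑ a, ∑ a', X a a' * choiMatrix T (b, a) (b', a') := by
  conv_lhs => rw [matrix_eq_sum_single X]
  have : ∀ a a', Matrix.single a a' (X a a') = X a a' • Matrix.single a a' (1 : ℂ) := by simp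
  simp only [this, map_sum, map_smul, Matrix.sum_apply, Matrix.smul_apply, smul_eq_mul, choiMatrix,
    Matrix.of_apply]

theorem choiMatrix_posSemidef {A B : Type*} [Fintype A] [DecidableEq A] [Fintype B]
    {T : Matrix A A ℂ →ₗ[ℂ] Matrix B B ℂ} (hT : IsQuantumChannel T) :
    (choiMatrix T).PosSemidef := by
  let e := Fintype.equivFin A
  -- The unnormalised maximally entangled vector; the ampliation of its projector is the Choi matrix
  -- up to relabelling.
  let v : Fin (Fintype.card A) × A → ℂ := fun p => if e p.2 = p.1 then 1 else 0
  have h := (hT.1 _ _ (posSemidef_vecMulVec_self_star v)).submatrix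
    fun p : B × A => (e p.2, p.1)
  convert h using 1
  ext p q
  simp only [choiMatrix, ampliation, Matrix.of_apply, submatrix_apply]
  refine congrFun (congrFun (congrArg T ?_) _) _
  ext a a'
  by_cases h1 : a = p.2 <;> by_cases h2 : a' = q.2 <;>
    simp [v, vecMulVec_apply, h1, h2, eq_comm]

theorem choiMatrix_covariant [Group G] {W : G →* unitaryGroup A ℂ} {W' : G →* unitaryGroup B ℂ}
    {T : Matrix A A ℂ →ₗ[ℂ] Matrix B B ℂ} (hT : IsCovariantChannel W W' T) (g : G) :
    Commute (choiMatrix T) ((W' g : Matrix B B ℂ) ⊗ₖ (W g : Matrix A A ℂ).map star) := by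
  set w : Matrix A A ℂ := (W g).1 with hw
  set w' : Matrix B B ℂ := (W' g).1 with hw'
  have hwu : w * wᴴ = 1 := mem_unitaryGroup_iff.1 (W g).2
  have hwu' : w'ᴴ * w' = 1 := mem_unitaryGroup_iff'.1 (W' g).2
  have hconj : wᵀᴴ = w.map star := rfl
  have hwT : w.map star * wᵀ = 1 := by
    have := congrArg transpose hwu
    rw [transpose_mul, transpose_one] at this
    exact this
  -- Covariance evaluated on matrix units. Unitarity of both sides then turns it into a commutation
  -- relation.
  have h1 : ((1 : Matrix B B ℂ) ⊗ₖ wᵀ) * choiMatrix T * ((1 : Matrix B B ℂ) ⊗ₖ wᵀ)ᴴ =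
      (w' ⊗ₖ (1 : Matrix A A ℂ)) * choiMatrix T * (w' ⊗ₖ (1 : Matrix A A ℂ))ᴴ := by
    ext ⟨b, a⟩ ⟨b', a'⟩
    have h2 := congrFun (congrFun (hT.2 g (Matrix.single a a' 1)) b) b'
    rw [map_apply_eq_sum_choiMatrix] at h2
    have h3 : ∀ c c', (w * Matrix.single a a' (1 : ℂ) * wᴴ : Matrix A A ℂ) c c' = w c a * star (w c' a') := by
      intro c c'
      simp [Matrix.mul_apply, Matrix.single_apply, ite_and]
    have h4 : ∀ c c', T (Matrix.single a a' 1) c c' = choiMatrix T (c, a) (c', a') := fun _ _ => rfl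
    simp only [← hw, ← hw', h3] at h2
    simp only [conjTranspose_kronecker, conjTranspose_one, Matrix.mul_apply,
      Fintype.sum_prod_type, kroneckerMap_apply, Matrix.one_apply, ite_mul, one_mul, zero_mul,
      mul_ite, mul_one, mul_zero, Finset.sum_ite_irrel, Finset.sum_const_zero, Finset.sum_ite_eq,
      Finset.sum_ite_eq', Finset.mem_univ, if_true, transpose_apply, conjTranspose_apply,
      Finset.sum_mul, h4] at h2 ⊢
    rw [← h2, Finset.sum_comm]
    exact Finset.sum_congr rfl fun c _ => Finset.sum_congr rfl fun c' _ => by ring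
  have h2 : ((1 : Matrix B B ℂ) ⊗ₖ wᵀ)ᴴ * ((1 : Matrix B B ℂ) ⊗ₖ wᵀ) = 1 := by
    rw [conjTranspose_kronecker, ← mul_kronecker_mul, hconj, hwT, conjTranspose_one, Matrix.one_mul,
      one_kronecker_one]
  have h3 : (w' ⊗ₖ (1 : Matrix A A ℂ))ᴴ * (w' ⊗ₖ (1 : Matrix A A ℂ)) = 1 := by
    rw [conjTranspose_kronecker, ← mul_kronecker_mul, hwu', conjTranspose_one, Matrix.one_mul,
      one_kronecker_one]
  have h4 : w' ⊗ₖ w.map star = ((1 : Matrix B B ℂ) ⊗ₖ wᵀ)ᴴ * (w' ⊗ₖ (1 : Matrix A A ℂ)) := by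
    rw [conjTranspose_kronecker, ← mul_kronecker_mul, hconj, conjTranspose_one, Matrix.one_mul,
      Matrix.mul_one]
  change _ * _ = _ * _
  rw [h4]
  calc choiMatrix T * (((1 : Matrix B B ℂ) ⊗ₖ wᵀ)ᴴ * (w' ⊗ₖ (1 : Matrix A A ℂ)))
      = (((1 : Matrix B B ℂ) ⊗ₖ wᵀ)ᴴ * ((1 : Matrix B B ℂ) ⊗ₖ wᵀ)) * choiMatrix T *
          (((1 : Matrix B B ℂ) ⊗ₖ wᵀ)ᴴ * (w' ⊗ₖ (1 : Matrix A A ℂ))) := by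
        rw [h2, Matrix.one_mul]
    _ = ((1 : Matrix B B ℂ) ⊗ₖ wᵀ)ᴴ * (((1 : Matrix B B ℂ) ⊗ₖ wᵀ) * choiMatrix T *
          ((1 : Matrix B B ℂ) ⊗ₖ wᵀ)ᴴ) * (w' ⊗ₖ (1 : Matrix A A ℂ)) := by
        simp only [Matrix.mul_assoc]
    _ = ((1 : Matrix B B ℂ) ⊗ₖ wᵀ)ᴴ * (w' ⊗ₖ (1 : Matrix A A ℂ)) * choiMatrix T *
          ((w' ⊗ₖ (1 : Matrix A A ℂ))ᴴ * (w' ⊗ₖ (1 : Matrix A A ℂ))) := by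
        rw [h1]
        simp only [Matrix.mul_assoc]
    _ = _ := by rw [h3, Matrix.mul_one]

/-- The complex conjugate of a unitary representation. -/
def conjRep [Group G] (W : G →* unitaryGroup A ℂ) : G →* unitaryGroup A ℂ where
  toFun g := ⟨(W g : Matrix A A ℂ).map star, mem_unitaryGroup_iff.2 (by
    have h1 := congrArg transpose (mem_unitaryGroup_iff.1 (W g).2)
    rw [transpose_mul, transpose_one] at h1
    have h2 : star ((W g : Matrix A A ℂ).map star) = (W g : Matrix A A ℂ)ᵀ := by
      ext a b
      simp
    rw [h2]
    exact h1)⟩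
  map_one' := by
    apply Subtype.ext
    simp
  map_mul' g h := by
    apply Subtype.ext
    ext a b
    simp [Matrix.mul_apply]

theorem conjRep_continuous [Group G] [TopologicalSpace G] {W : G →* unitaryGroup A ℂ}
    (hW : Continuous W) : Continuous (conjRep W) :=
  Continuous.subtype_mk (continuous_matrix fun a b =>
    ((continuous_subtype_val.comp hW).matrix_elem a b).star) _

/-- The block column of the Kraus operators that are the columns of `Q`. -/
def krausColumn (Q : Matrix (B × A) F ℂ) : Matrix (B × F) A ℂ :=
  Matrix.of fun p a => Q (p.1, a) p.2

theorem krausColumn_kronecker_mul {A B F : Type*} [Fintype A] [Fintype B] [Fintype F]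
    [DecidableEq F] (M : Matrix B B ℂ) (N : Matrix A A ℂ)
    (Q : Matrix (B × A) F ℂ) :
    krausColumn ((M ⊗ₖ N) * Q) = (M ⊗ₖ (1 : Matrix F F ℂ)) * krausColumn Q * Nᵀ := by
  ext ⟨b, i⟩ a
  simp only [krausColumn, Matrix.of_apply, Matrix.mul_apply, Fintype.sum_prod_type,
    kroneckerMap_apply, Matrix.one_apply, ite_mul, zero_mul, mul_ite, mul_one, mul_zero,
    Finset.sum_ite_eq, Finset.mem_univ, if_true, transpose_apply, Finset.sum_mul]
  rw [Finset.sum_comm]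
  exact Finset.sum_congr rfl fun c _ => Finset.sum_congr rfl fun c' _ => by ring

theorem krausColumn_mul {A B F : Type*} [Fintype B] [DecidableEq B] [Fintype F]
    (Q : Matrix (B × A) F ℂ) (R : Matrix F F ℂ) :
    krausColumn (Q * R) = ((1 : Matrix B B ℂ) ⊗ₖ Rᵀ) * krausColumn Q := by
  ext ⟨b, i⟩ a
  simp only [krausColumn, Matrix.of_apply, Matrix.mul_apply, Fintype.sum_prod_type,
    kroneckerMap_apply, Matrix.one_apply, ite_mul, one_mul, zero_mul, Finset.sum_ite_irrel,
    Finset.sum_const_zero, Finset.sum_ite_eq, Finset.mem_univ, if_true, transpose_apply]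
  exact Finset.sum_congr rfl fun c _ => mul_comm _ _

/-- The covariant Stinespring dilation, built from the square root of the Choi matrix. -/
theorem exists_covariant_dilation [Group G] {W : G →* unitaryGroup A ℂ}
    {W' : G →* unitaryGroup B ℂ} {T : Matrix A A ℂ →ₗ[ℂ] Matrix B B ℂ}
    (hT : IsCovariantChannel W W' T) : ∃ K : Matrix (B × (B × A)) A ℂ, Kᴴ * K = 1 ∧
      (∀ g, K * (W g : Matrix A A ℂ) =
        (tensorRep W' (tensorRep (conjRep W') W) g : Matrix (B × (B × A)) (B × (B × A)) ℂ) * K) ∧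
      ∀ X, T X = partialTrace (K * X * Kᴴ) := by
  -- The columns of the square root are Kraus operators. As `Q` commutes with the symmetry, it
  -- permits moving the group action from the rows to the columns, that is, to the environment.
  obtain ⟨Q, hQh, hQ, hQc⟩ := exists_hermitian_sqrt (choiMatrix_posSemidef hT.1)
  have hTK : ∀ X, T X = partialTrace (krausColumn Q * X * (krausColumn Q)ᴴ) := by
    intro X
    ext b b'
    have h1 : ∀ p q, choiMatrix T p q = ∑ i, Q p i * star (Q q i) := by
      intro p q
      rw [← hQ]
      nth_rewrite 2 [← hQh]
      rfl
    rw [map_apply_eq_sum_choiMatrix]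
    simp only [h1, partialTrace_apply, Matrix.mul_apply, krausColumn, Matrix.of_apply,
      conjTranspose_apply, Finset.mul_sum, Finset.sum_mul]
    calc _ = ∑ a', ∑ a, ∑ i, X a a' * (Q (b, a) i * star (Q (b', a') i)) := Finset.sum_comm
      _ = ∑ a', ∑ i, ∑ a, X a a' * (Q (b, a) i * star (Q (b', a') i)) :=
          Finset.sum_congr rfl fun a' _ => Finset.sum_comm
      _ = ∑ i, ∑ a', ∑ a, X a a' * (Q (b, a) i * star (Q (b', a') i)) := Finset.sum_comm
      _ = _ := Finset.sum_congr rfl fun i _ => Finset.sum_congr rfl fun a' _ =>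
          Finset.sum_congr rfl fun a _ => by ring
  refine ⟨krausColumn Q, ?_, fun g => ?_, hTK⟩
  -- Trace preservation says that `Kᴴ * K` and `1` have the same trace against every `X`.
  · refine Matrix.ext_iff_trace_mul_left.2 fun X => ?_
    rw [Matrix.mul_one, ← hT.1.2 X, hTK, trace_partialTrace, ← Matrix.mul_assoc, trace_mul_comm,
      ← Matrix.mul_assoc]
  · set w : Matrix A A ℂ := (W g).1 with hw
    set w' : Matrix B B ℂ := (W' g).1 with hw'
    have hwu : wᴴ * w = 1 := mem_unitaryGroup_iff'.1 (W g).2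
    let R : Matrix (B × A) (B × A) ℂ := w' ⊗ₖ w.map star
    have hR : R ∈ unitaryGroup (B × A) ℂ := (tensorRep W' (conjRep W) g).2
    have h1 := congrArg krausColumn (hQc _ (choiMatrix_covariant hT g)).eq
    rw [krausColumn_mul, krausColumn_kronecker_mul] at h1
    have h2 : (w.map star)ᵀ = wᴴ := rfl
    -- The environment carries the complex conjugate of `R`, which is the conjugate of `w'` tensored
    -- with `w`.
    have h3 : (tensorRep W' (tensorRep (conjRep W') W) g :
        Matrix (B × (B × A)) (B × (B × A)) ℂ) =
          ((1 : Matrix B B ℂ) ⊗ₖ Rᵀᴴ) * (w' ⊗ₖ (1 : Matrix (B × A) (B × A) ℂ)) := by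
      rw [← mul_kronecker_mul, Matrix.one_mul, Matrix.mul_one]
      change w' ⊗ₖ (w'.map star ⊗ₖ w) = w' ⊗ₖ Rᵀᴴ
      congr 1
      ext p q
      simp [R]
    have h4 : ((1 : Matrix B B ℂ) ⊗ₖ Rᵀᴴ) * ((1 : Matrix B B ℂ) ⊗ₖ Rᵀ) = 1 := by
      have := congrArg transpose (mem_unitaryGroup_iff.1 hR)
      rw [transpose_mul, transpose_one] at this
      rw [← mul_kronecker_mul, Matrix.one_mul]
      change (1 : Matrix B B ℂ) ⊗ₖ ((star R)ᵀ * Rᵀ) = 1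
      rw [this, one_kronecker_one]
    have h5 : (w' ⊗ₖ (1 : Matrix (B × A) (B × A) ℂ)) * krausColumn Q =
        ((1 : Matrix B B ℂ) ⊗ₖ Rᵀ) * krausColumn Q * w := by
      change ((1 : Matrix B B ℂ) ⊗ₖ Rᵀ) * krausColumn Q = _ at h1
      rw [h1, h2, Matrix.mul_assoc _ wᴴ, hwu, Matrix.mul_one]
    rw [h3, Matrix.mul_assoc, h5, ← Matrix.mul_assoc, ← Matrix.mul_assoc, h4, Matrix.one_mul]

end Stinespring

/-! ### Pure catalysts -/

section PureCatalyst

variable {G S C F : Type*} [Group G] [Fintype S] [DecidableEq S]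
  [Fintype C] [DecidableEq C] [Fintype F] [DecidableEq F]

/-- A covariant partial isometry extends to a covariant channel: the part of the state outside of
its support is replaced by the maximally mixed state. -/
theorem exists_covariantChannel_of_partialIsometry [Nonempty S] {WS WS' : G →* unitaryGroup S ℂ}
    {WF : G →* unitaryGroup F ℂ} {V : Matrix (S × F) S ℂ} (hV : V * Vᴴ * V = V)
    (hVW : ∀ g, V * (WS g : Matrix S S ℂ) =
      (tensorRep WS' WF g : Matrix (S × F) (S × F) ℂ) * V) :
    ∃ T : Matrix S S ℂ →ₗ[ℂ] Matrix S S ℂ, IsCovariantChannel WS WS' T ∧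
      ∀ X, Vᴴ * V * X = X → T X = partialTrace (V * X * Vᴴ) := by
  set P : Matrix S S ℂ := 1 - Vᴴ * V with hP
  have hPh : Pᴴ = P := by simp [hP, conjTranspose_mul]
  have hPP : P * P = P := by
    have : Vᴴ * V * (Vᴴ * V) = Vᴴ * V := by
      rw [Matrix.mul_assoc, ← Matrix.mul_assoc V, hV]
    simp only [hP, Matrix.sub_mul, Matrix.mul_sub, Matrix.one_mul, Matrix.mul_one, this]
    abel
  have hcard : (Fintype.card S : ℂ) ≠ 0 := Nat.cast_ne_zero.2 Fintype.card_ne_zero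
  let T : Matrix S S ℂ →ₗ[ℂ] Matrix S S ℂ :=
    { toFun := fun X => partialTrace (V * X * Vᴴ) +
        ((Fintype.card S : ℂ)⁻¹ * (P * X).trace) • (1 : Matrix S S ℂ)
      map_add' := fun X Y => by
        have : partialTrace (V * (X + Y) * Vᴴ) =
            partialTrace (V * X * Vᴴ) + partialTrace (V * Y * Vᴴ) := by
          ext a b
          simp [partialTrace_apply, Matrix.mul_add, Matrix.add_mul, Finset.sum_add_distrib]
        rw [this, Matrix.mul_add, trace_add, mul_add, add_smul]
        abel
      map_smul' := fun c X => by
        have : partialTrace (V * (c • X) * Vᴴ) = c • partialTrace (V * X * Vᴴ) := by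
          ext a b
          simp [partialTrace_apply, Finset.mul_sum]
        rw [this, Matrix.mul_smul, trace_smul, RingHom.id_apply, smul_add, smul_smul, smul_eq_mul]
        congr 2
        ring }
  have hTX : ∀ X, T X = partialTrace (V * X * Vᴴ) +
    ((Fintype.card S : ℂ)⁻¹ * (P * X).trace) • (1 : Matrix S S ℂ) := fun _ => rfl
  refine ⟨T, ⟨⟨fun k X hX => ?_, fun X => ?_⟩, fun g X => ?_⟩, fun X hX => ?_⟩
  · let r : ℂ := ((Real.sqrt (Fintype.card S : ℝ)⁻¹ : ℝ) : ℂ)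
    have hr : r * r = (Fintype.card S : ℂ)⁻¹ := by
      simp only [r]
      rw [← Complex.ofReal_mul, Real.mul_self_sqrt (by positivity)]
      simp
    -- One Kraus operator for each basis vector of `F`, and the operators `r |a⟩⟨b| P` for the
    -- replacement by the maximally mixed state; `r` is the square root of its eigenvalue.
    let K : F ⊕ (S × S) → Matrix S S ℂ := Sum.elim (fun f => Matrix.of fun a b => V (a, f) b)
      fun q => r • (Matrix.single q.1 q.2 1 * P)
    refine ampliation_posSemidef_of_kraus K (fun X => ?_) k hX
    have h1 : partialTrace (V * X * Vᴴ) = ∑ f, K (Sum.inl f) * X * (K (Sum.inl f))ᴴ := by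
      ext a b
      simp [partialTrace_apply, K, Matrix.sum_apply, Matrix.mul_apply]
    have h2 : ∀ q, K (Sum.inr q) * X * (K (Sum.inr q))ᴴ =
        ((Fintype.card S : ℂ)⁻¹ * (P * X * P) q.2 q.2) • Matrix.single q.1 q.1 1 := by
      intro q
      have h3 : Matrix.single q.1 q.2 (1 : ℂ) * (P * X * P) * Matrix.single q.2 q.1 (1 : ℂ) =
          ((P * X * P) q.2 q.2) • Matrix.single q.1 q.1 1 := by
        rw [Matrix.single_mul_mul_single]
        simp
      have h4 : (Matrix.single q.1 q.2 (1 : ℂ))ᴴ = Matrix.single q.2 q.1 (1 : ℂ) := by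
        simp
      have h5 : star r = r := Complex.conj_ofReal _
      change (r • (Matrix.single q.1 q.2 1 * P)) * X * (r • (Matrix.single q.1 q.2 1 * P))ᴴ = _
      rw [conjTranspose_smul, conjTranspose_mul, hPh, h4, h5, Matrix.smul_mul, Matrix.smul_mul,
        Matrix.mul_smul, smul_smul, hr, mul_smul, ← h3]
      simp only [Matrix.mul_assoc]
    have h6 : (P * X).trace = (P * X * P).trace := by
      rw [trace_mul_comm (P * X), ← Matrix.mul_assoc, hPP]
    have h7 : ∑ a : S, Matrix.single a a (1 : ℂ) = 1 := by
      ext i j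
      simp [Matrix.sum_apply, Matrix.single_apply, Matrix.one_apply, ite_and]
    rw [Fintype.sum_sum_type, hTX, h1]
    congr 1
    simp only [h2, Fintype.sum_prod_type_right]
    simp only [← Finset.smul_sum, h7, ← Finset.sum_smul, ← Finset.mul_sum]
    rw [h6]
    rfl
  · rw [hTX, trace_add, trace_partialTrace, trace_smul, trace_one, smul_eq_mul, trace_mul_comm,
      ← Matrix.mul_assoc, hP, Matrix.sub_mul, Matrix.one_mul, trace_sub]
    field_simp
    ring
  · have hVg := hVW g
    have hVg' := congrArg conjTranspose hVg
    rw [conjTranspose_mul, conjTranspose_mul] at hVg'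
    have hWu : (WS g : Matrix S S ℂ)ᴴ * (WS g : Matrix S S ℂ) = 1 := mem_unitaryGroup_iff'.1 (WS g).2
    have hWu' : (WS' g : Matrix S S ℂ) * (WS' g : Matrix S S ℂ)ᴴ = 1 :=
      mem_unitaryGroup_iff.1 (WS' g).2
    have hTu : (tensorRep WS' WF g : Matrix (S × F) (S × F) ℂ)ᴴ *
        (tensorRep WS' WF g : Matrix (S × F) (S × F) ℂ) = 1 :=
      mem_unitaryGroup_iff'.1 (tensorRep WS' WF g).2
    -- The initial projection of an intertwiner is invariant, so the replaced weight does not change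
    -- under the group.
    have hPW : (WS g : Matrix S S ℂ)ᴴ * P * (WS g : Matrix S S ℂ) = P := by
      have : (WS g : Matrix S S ℂ)ᴴ * (Vᴴ * V) * (WS g : Matrix S S ℂ) = Vᴴ * V := by
        calc _ = ((WS g : Matrix S S ℂ)ᴴ * Vᴴ) * (V * (WS g : Matrix S S ℂ)) := by
              simp only [Matrix.mul_assoc]
          _ = Vᴴ * ((tensorRep WS' WF g : Matrix (S × F) (S × F) ℂ)ᴴ *
              (tensorRep WS' WF g : Matrix (S × F) (S × F) ℂ)) * V := by
              rw [hVg, hVg']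
              simp only [Matrix.mul_assoc]
          _ = _ := by rw [hTu, Matrix.mul_one]
      rw [hP, Matrix.mul_sub, Matrix.sub_mul, this, Matrix.mul_one, hWu]
    have h1 : (P * ((WS g : Matrix S S ℂ) * X * (WS g : Matrix S S ℂ)ᴴ)).trace = (P * X).trace := by
      rw [← Matrix.mul_assoc, trace_mul_comm, ← Matrix.mul_assoc, ← Matrix.mul_assoc, hPW]
    have h2 : V * ((WS g : Matrix S S ℂ) * X * (WS g : Matrix S S ℂ)ᴴ) * Vᴴ =
        (tensorRep WS' WF g : Matrix (S × F) (S × F) ℂ) * (V * X * Vᴴ) *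
          (tensorRep WS' WF g : Matrix (S × F) (S × F) ℂ)ᴴ := by
      calc _ = (V * (WS g : Matrix S S ℂ)) * X * ((WS g : Matrix S S ℂ)ᴴ * Vᴴ) := by
            simp only [Matrix.mul_assoc]
        _ = _ := by
            rw [hVg, hVg']
            simp only [Matrix.mul_assoc]
    rw [hTX, hTX, h1, h2, Matrix.mul_add, Matrix.add_mul, Matrix.mul_smul, Matrix.smul_mul,
      Matrix.mul_one, hWu']
    congr 1
    exact partialTrace_conj _ _ (mem_unitaryGroup_iff'.1 (WF g).2)
  · have : P * X = 0 := by rw [hP, Matrix.sub_mul, hX, Matrix.one_mul, sub_self]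
    rw [hTX, this]
    simp

/-- In the covariant dilation of `T` the purity of `σ` decouples the catalyst from system and
environment. The isometry then maps `ρ ⊗ σ` to `τ ⊗ σ`, and cancelling the catalyst leaves a
covariant partial isometry from `S` to `S ⊗ F`. -/
theorem exists_covariantChannel_of_pure_catalysis [TopologicalSpace G] [ConnectedSpace G]
    {WS WS' : G →* unitaryGroup S ℂ} {WC : G →* unitaryGroup C ℂ} (hWS : Continuous WS)
    (hWS' : Continuous WS') (hWC : Continuous WC) {ρ ρ' : Matrix S S ℂ} {σ : Matrix C C ℂ}
    (hρ : IsDensityMatrix ρ) (hσ : IsPureState σ)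
    {T : Matrix (S × C) (S × C) ℂ →ₗ[ℂ] Matrix (S × C) (S × C) ℂ}
    (hT : IsCovariantChannel (tensorRep WS WC) (tensorRep WS' WC) T)
    (hTρ : T (ρ ⊗ₖ σ) = ρ' ⊗ₖ σ) :
    ∃ T' : Matrix S S ℂ →ₗ[ℂ] Matrix S S ℂ, IsCovariantChannel WS WS' T' ∧ T' ρ = ρ' := by
  obtain ⟨K, hK, hKW, hKT⟩ := exists_covariant_dilation hT
  have hσd := hσ.isDensityMatrix
  have hne : Nonempty S := by
    by_contra h
    rw [not_nonempty_iff] at h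
    simpa using hρ.2
  have hY : (K * (ρ ⊗ₖ σ) * Kᴴ).PosSemidef :=
    (hρ.1.kronecker hσd.1).mul_mul_conjTranspose_same K
  obtain ⟨τ, hτ⟩ := exists_reorder_eq_of_isPureState hY hσ (by rw [← hKT, hTρ])
  have hτh : τ.IsHermitian := by
    refine kronecker_left_injective hσd.2 ?_
    have h1 : (τ ⊗ₖ σ)ᴴ = τ ⊗ₖ σ := by rw [← hτ, ← reorder_conjTranspose, hY.1.eq]
    rwa [conjTranspose_kronecker, hσd.1.1.eq] at h1
  set WF := tensorRep (conjRep (tensorRep WS' WC)) (tensorRep WS WC) with hWF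
  have hWFc : Continuous WF := tensorRep_continuous
    (conjRep_continuous (tensorRep_continuous hWS' hWC)) (tensorRep_continuous hWS hWC)
  let r := reorderEquiv S C ((S × C) × (S × C))
  -- Only the output is reordered, so that the catalyst becomes the last factor on both sides.
  let K' : Matrix ((S × ((S × C) × (S × C))) × C) (S × C) ℂ := K.submatrix r id
  obtain ⟨V, hV, hVW, hVρ, hVs, -⟩ := exists_partialIsometry_of_catalysis hWS
    (tensorRep_continuous hWS' hWFc) hWC hρ.1.1 hτh hσd (K := K')
    (by
      change (K.submatrix r id)ᴴ * K.submatrix r id = 1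
      rw [conjTranspose_submatrix, submatrix_mul_equiv, hK, submatrix_id_id])
    (fun g => by
      have h1 := congrArg (fun M => M.submatrix r id) (hKW g)
      have h2 : reorder (tensorRep (tensorRep WS' WC) WF g :
          Matrix ((S × C) × ((S × C) × (S × C))) ((S × C) × ((S × C) × (S × C))) ℂ) =
            (tensorRep WS' WF g : Matrix (S × ((S × C) × (S × C))) _ ℂ) ⊗ₖ
              (WC g : Matrix C C ℂ) := reorder_kronecker _ _ _
      rw [← h2, reorder_eq_submatrix, submatrix_mul_equiv]
      exact h1)
    (by
      rw [← hτ]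
      rfl)
  obtain ⟨T', hT', hT'V⟩ := exists_covariantChannel_of_partialIsometry hV hVW
  refine ⟨T', hT', kronecker_left_injective hσd.2 ?_⟩
  rw [hT'V ρ hVs, hVρ, ← partialTrace_of_reorder_eq hτ, ← hKT, hTρ]

/-- The dilation is part of the definition of a thermal operation. Purity makes its output a
product, and the exact uncorrelated case applies with the same bath. -/
theorem exists_thermalOperation_of_pure_catalysis {β : ℝ} {HS : Matrix S S ℂ} {HC : Matrix C C ℂ}
    (hHS : HS.IsHermitian) (hHC : HC.IsHermitian) {ρ ρ' : Matrix S S ℂ} {σ : Matrix C C ℂ}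
    (hρ : IsDensityMatrix ρ) (hσ : IsPureState σ)
    {T : Matrix (S × C) (S × C) ℂ →ₗ[ℂ] Matrix (S × C) (S × C) ℂ}
    (hT : IsThermalOperation β (totalHamiltonian HS HC) T) (hTρ : T (ρ ⊗ₖ σ) = ρ' ⊗ₖ σ) :
    ∃ T' : Matrix S S ℂ →ₗ[ℂ] Matrix S S ℂ, IsThermalOperation β HS T' ∧ T' ρ = ρ' := by
  obtain ⟨n, HE, U, hn, hHE, hU, rfl⟩ := hT
  have hσd := hσ.isDensityMatrix
  have hγ := gibbsState_posSemidef β hHE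
  obtain ⟨τ, hτ⟩ := exists_reorder_eq_of_isPureState
    (((hρ.1.kronecker hσd.1).kronecker hγ).mul_mul_conjTranspose_same
      (U : Matrix ((S × C) × Fin n) ((S × C) × Fin n) ℂ)) hσ hTρ
  obtain ⟨V, -, hVH, hV⟩ := exists_energy_conserving_of_catalysis hHS hHC hHE hρ.1.1 hσd hγ.1 hU hτ
  have : Nonempty (Fin n) := ⟨⟨0, hn⟩⟩
  exact ⟨_, isThermalOperation_dilatedMap hHE hVH,
    kronecker_left_injective hσd.2 (hV.symm.trans hTρ)⟩

end PureCatalyst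

end QuantumCatalysis

end

open QuantumCatalysis in
theorem theorem1
    -- a connected (finite-dimensional, real, smooth) Lie group
    {EG : Type*} [NormedAddCommGroup EG] [NormedSpace ℝ EG] [FiniteDimensional ℝ EG]
    {HG : Type*} [TopologicalSpace HG] (I : ModelWithCorners ℝ EG HG) [I.Boundaryless]
    {G : Type*} [Group G] [TopologicalSpace G] [ChartedSpace HG G] [LieGroup I ∞ G]
    [ConnectedSpace G]
    -- system, catalyst, environment
    {S C E : Type*} [Fintype S] [DecidableEq S] [Fintype C] [DecidableEq C]
    [Fintype E] [DecidableEq E] :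
    -- (1) the main statement
    (∀ (WS WS' : G →* Matrix.unitaryGroup S ℂ) (WC : G →* Matrix.unitaryGroup C ℂ),
      Continuous WS → Continuous WS' → Continuous WC →
      ∀ (ρ ρ' : Matrix S S ℂ) (σ : Matrix C C ℂ),
      IsDensityMatrix ρ → IsDensityMatrix ρ' → IsDensityMatrix σ →
      ∀ U : Matrix.unitaryGroup (S × C) ℂ,
      (U : Matrix (S × C) (S × C) ℂ) * (ρ ⊗ₖ σ) *
          (U : Matrix (S × C) (S × C) ℂ).conjTranspose = ρ' ⊗ₖ σ →
      Intertwines U (tensorRep WS WC) (tensorRep WS' WC) →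
      ∃ V : Matrix.unitaryGroup S ℂ,
        (V : Matrix S S ℂ) * ρ * (V : Matrix S S ℂ).conjTranspose = ρ' ∧
        Intertwines V WS WS') ∧
    -- (2) asymmetry: an unchanged catalyst, uncorrelated with system and environment, is useless
    (∀ (WS WS' : G →* Matrix.unitaryGroup S ℂ) (WC : G →* Matrix.unitaryGroup C ℂ)
      (WE WE' : G →* Matrix.unitaryGroup E ℂ),
      Continuous WS → Continuous WS' → Continuous WC → Continuous WE → Continuous WE' →
      ∀ (ρ : Matrix S S ℂ) (σ : Matrix C C ℂ) (γ : Matrix E E ℂ)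
        (τ : Matrix (S × E) (S × E) ℂ),
      IsDensityMatrix ρ → IsDensityMatrix σ → IsDensityMatrix γ → IsSymmetricState WE γ →
      ∀ U : Matrix.unitaryGroup ((S × C) × E) ℂ,
      Intertwines U (tensorRep (tensorRep WS WC) WE) (tensorRep (tensorRep WS' WC) WE') →
      reorder ((U : Matrix ((S × C) × E) ((S × C) × E) ℂ) * ((ρ ⊗ₖ σ) ⊗ₖ γ) *
          (U : Matrix ((S × C) × E) ((S × C) × E) ℂ).conjTranspose) = τ ⊗ₖ σ →
      ∃ V : Matrix.unitaryGroup (S × E) ℂ,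
        (V : Matrix (S × E) (S × E) ℂ) * (ρ ⊗ₖ γ) *
          (V : Matrix (S × E) (S × E) ℂ).conjTranspose = τ ∧
        Intertwines V (tensorRep WS WE) (tensorRep WS' WE') ∧
        IsCovariantChannel WS WS' (dilatedMap V γ) ∧
        dilatedMap U γ (ρ ⊗ₖ σ) = (dilatedMap V γ ρ) ⊗ₖ σ) ∧
    -- (3) athermality: an unchanged catalyst, uncorrelated with system and bath, is useless
    (∀ (β : ℝ) (HS : Matrix S S ℂ) (HC : Matrix C C ℂ) (HE : Matrix E E ℂ),
      0 < β → HS.IsHermitian → HC.IsHermitian → HE.IsHermitian → Nonempty E →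
      ∀ (ρ : Matrix S S ℂ) (σ : Matrix C C ℂ) (τ : Matrix (S × E) (S × E) ℂ),
      IsDensityMatrix ρ → IsDensityMatrix σ →
      ∀ U : Matrix.unitaryGroup ((S × C) × E) ℂ,
      Commute (U : Matrix ((S × C) × E) ((S × C) × E) ℂ)
        (totalHamiltonian (totalHamiltonian HS HC) HE) →
      reorder ((U : Matrix ((S × C) × E) ((S × C) × E) ℂ) * ((ρ ⊗ₖ σ) ⊗ₖ gibbsState β HE) *
          (U : Matrix ((S × C) × E) ((S × C) × E) ℂ).conjTranspose) = τ ⊗ₖ σ →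
      ∃ V : Matrix.unitaryGroup (S × E) ℂ,
        (V : Matrix (S × E) (S × E) ℂ) * (ρ ⊗ₖ gibbsState β HE) *
          (V : Matrix (S × E) (S × E) ℂ).conjTranspose = τ ∧
        Commute (V : Matrix (S × E) (S × E) ℂ) (totalHamiltonian HS HE) ∧
        IsThermalOperation β HS (dilatedMap V (gibbsState β HE)) ∧
        dilatedMap U (gibbsState β HE) (ρ ⊗ₖ σ) = (dilatedMap V (gibbsState β HE) ρ) ⊗ₖ σ) ∧
    -- (4) asymmetry: pure catalysts are useless
    (∀ (WS WS' : G →* Matrix.unitaryGroup S ℂ) (WC : G →* Matrix.unitaryGroup C ℂ),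
      Continuous WS → Continuous WS' → Continuous WC →
      ∀ (ρ ρ' : Matrix S S ℂ) (σ : Matrix C C ℂ),
      IsDensityMatrix ρ → IsDensityMatrix ρ' → IsPureState σ →
      ∀ T : Matrix (S × C) (S × C) ℂ →ₗ[ℂ] Matrix (S × C) (S × C) ℂ,
      IsCovariantChannel (tensorRep WS WC) (tensorRep WS' WC) T →
      T (ρ ⊗ₖ σ) = ρ' ⊗ₖ σ →
      ∃ T' : Matrix S S ℂ →ₗ[ℂ] Matrix S S ℂ, IsCovariantChannel WS WS' T' ∧ T' ρ = ρ') ∧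
    -- (5) athermality: pure catalysts are useless
    (∀ (β : ℝ) (HS : Matrix S S ℂ) (HC : Matrix C C ℂ),
      0 < β → HS.IsHermitian → HC.IsHermitian →
      ∀ (ρ ρ' : Matrix S S ℂ) (σ : Matrix C C ℂ),
      IsDensityMatrix ρ → IsDensityMatrix ρ' → IsPureState σ →
      ∀ T : Matrix (S × C) (S × C) ℂ →ₗ[ℂ] Matrix (S × C) (S × C) ℂ,
      IsThermalOperation β (totalHamiltonian HS HC) T →
      T (ρ ⊗ₖ σ) = ρ' ⊗ₖ σ →
      ∃ T' : Matrix S S ℂ →ₗ[ℂ] Matrix S S ℂ, IsThermalOperation β HS T' ∧ T' ρ = ρ') := by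
  refine ⟨?_, ?_, ?_, ?_, ?_⟩
  · intro WS WS' WC hWS hWS' hWC ρ ρ' σ hρ hρ' hσ U hU hUW
    exact exists_unitary_of_catalysis hWS hWS' hWC hρ.1.1 hρ'.1.1 hσ hU hUW
  · intro WS WS' WC WE WE' hWS hWS' hWC hWE hWE' ρ σ γ τ hρ hσ hγ hsymm U hUW hU
    obtain ⟨V, hV, hVW, h⟩ := exists_unitary_of_catalysis_environment hWS hWS' hWC hWE hWE'
      hρ.1.1 hσ hγ.1.1 hUW hU
    exact ⟨V, hV, hVW, dilatedMap_isCovariantChannel hγ hsymm hVW, h⟩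
  · intro β HS HC HE _ hHS hHC hHE hE ρ σ τ hρ hσ U hUH hU
    obtain ⟨V, hV, hVH, h⟩ := exists_energy_conserving_of_catalysis hHS hHC hHE hρ.1.1 hσ
      (gibbsState_posSemidef β hHE).1 hUH hU
    exact ⟨V, hV, hVH, isThermalOperation_dilatedMap hHE hVH, h⟩
  · intro WS WS' WC hWS hWS' hWC ρ ρ' σ hρ _ hσ T hT hTρ
    exact exists_covariantChannel_of_pure_catalysis hWS hWS' hWC hρ hσ hT hTρ
  · intro β HS HC _ hHS hHC ρ ρ' σ hρ _ hσ T hT hTρ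
    exact exists_thermalOperation_of_pure_catalysis hHS hHC hρ hσ hT hTρ
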